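/- Let $M$ be a compact (Hausdorff, boundaryless) $C^\infty$ manifold of dimension $n+1$, $n\ge 1$. A smooth codimension-one foliation $F$ of $M$ is a partition of $M$ into path-connected subsets, called leaves, such that every point of $M$ lies in the domain $U$ of a chart $\varphi$ of the smooth structure with the following property: for every leaf $L$ meeting $U$, the connected components of $\varphi(U\cap L)$ are sets of the form $\{z\in\varphi(U): z_{n+1}=c\}$. Each leaf $L$ then carries, besides the topology induced from $M$, a leaf topology: its topology as an immersed $n$-dimensional submanifold. $F$ is transversely oriented if there is a $C^\infty$ vector field on $M$ which is nowhere tangent to the leaves. For a leaf $L$ let $\Omega(L)$ be the set of points $y\in M$ for which there is a sequence of points of $L$ that converges to $y$ in $M$ but does not converge to $y$ in the leaf topology of $L$. Write $L_1\le L_2$ if $L_1\subseteq\Omega(L_2)$, and $L_1<L_2$ if $L_1\le L_2$ and $L_1\ne L_2$. The depth of a leaf $L$ is $$d(L)=\sup\{k\ge 1:\ \text{there are leaves } L_1<L_2<\dots<L_k=L\}\in\{1,2,\dots,\infty\}.$$ Theorem. Let $F$ be a transversely oriented smooth codimension-one foliation of the compact manifold $M$. (a) For every leaf $L^0$ of $F$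 and every integer $k\ge1$, the set $\{L : L \text{ a leaf of } F,\ L<L^0,\ d(L)=k\}$ is either empty or finite. (b) Let $k$ be a natural number, let $(L_i)_{i\in\mathbb N}$ be leaves of $F$ with $d(L_i)\le k$ for all $i$, and let $x_i\in L_i$ be points converging in $M$ to a point $x$. Then the leaf $L(x)$ through $x$ satisfies $d(L(x))\le k$. -/

import Mathlib

open scoped Manifold ContDiff Topology

/-- The slice of a set `V ⊆ ℝⁿ` through `y` by the affine `k`-plane on which the last `n - k`
coordinates are constant. -/
def coordSlice (k : ℕ) {n : ℕ} (V : Set (EuclideanSpace ℝ (Fin n)))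
    (y : EuclideanSpace ℝ (Fin n)) : Set (EuclideanSpace ℝ (Fin n)) :=
  {z ∈ V | ∀ j : Fin n, k ≤ (j : ℕ) → z j = y j}

/-- `φ` is a chart of the smooth structure of `M` (with domain `U = φ.source`) such that, for every
member `L` of the family `leaves`, each connected component of `φ (U ∩ L)` is a slice of `φ (U)` by
a `k`-plane on which the last `n - k` coordinates are constant. -/
def IsFoliatedChart (k : ℕ) {n : ℕ} {M : Type*} [TopologicalSpace M]
    [ChartedSpace (EuclideanSpace ℝ (Fin n)) M] (leaves : Set (Set M))
    (φ : OpenPartialHomeomorph M (EuclideanSpace ℝ (Fin n))) : Prop :=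
  φ ∈ IsManifold.maximalAtlas (𝓡 n) ∞ M ∧
    ∀ L ∈ leaves, ∀ y ∈ φ '' (φ.source ∩ L),
      connectedComponentIn (φ '' (φ.source ∩ L)) y = coordSlice k φ.target y

/-- A `k`-dimensional smooth foliation of an `n`-dimensional manifold `M`, `0 < k < n`: a partition
of `M` into path-connected subsets (the leaves), with foliated charts around all points. -/
structure SmoothFoliation (k n : ℕ) (M : Type*) [TopologicalSpace M]
    [ChartedSpace (EuclideanSpace ℝ (Fin n)) M] where
  leaves : Set (Set M)
  dim_pos : 0 < k
  dim_lt : k < n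
  isPathConnected : ∀ L ∈ leaves, IsPathConnected L
  sUnion_leaves : ⋃₀ leaves = Set.univ
  pairwiseDisjoint : ∀ L ∈ leaves, ∀ L' ∈ leaves, L ≠ L' → Disjoint L L'
  exists_chart : ∀ p : M, ∃ φ : OpenPartialHomeomorph M (EuclideanSpace ℝ (Fin n)),
    p ∈ φ.source ∧ IsFoliatedChart k leaves φ

namespace SmoothFoliation

variable {k n : ℕ} {M : Type*} [TopologicalSpace M] [ChartedSpace (EuclideanSpace ℝ (Fin n)) M]

/-- The type of leaves, i.e. the leaf space `M/F`. -/
abbrev Leaf (F : SmoothFoliation k n M) : Type _ := {L : Set M // L ∈ F.leaves}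

/-- The topology on `M` in which a base is given by the relatively open subsets of the plaques of
foliated charts. As a topological space it is the disjoint union of the leaves, each leaf carrying
its own topology as an (immersed) submanifold. -/
@[reducible] def leafTopology (F : SmoothFoliation k n M) : TopologicalSpace M :=
  TopologicalSpace.generateFrom
    {S | ∃ φ : OpenPartialHomeomorph M (EuclideanSpace ℝ (Fin n)), IsFoliatedChart k F.leaves φ ∧
      ∃ p ∈ φ.source, ∃ W : Set M, IsOpen W ∧
        S = W ∩ {q ∈ φ.source | φ q ∈ coordSlice k φ.target (φ p)}}

/-- The limit set `Ω(L)`: the points `y` of `M` to which some sequence of points of `L` converges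
in `M` but not in the leaf topology. (If `y ∉ L`, a sequence in `L` never converges to `y` in the
leaf topology.) -/
def limitSet (F : SmoothFoliation k n M) (L : F.Leaf) : Set M :=
  {y | ∃ u : ℕ → M, (∀ m, u m ∈ L.1) ∧ Filter.Tendsto u Filter.atTop (𝓝 y) ∧
    ¬ Filter.Tendsto u Filter.atTop (@nhds M F.leafTopology y)}

/-- `L₁ ≤ L₂` if and only if `L₁ ⊆ Ω(L₂)`. -/
def LeafLE (F : SmoothFoliation k n M) (L₁ L₂ : F.Leaf) : Prop := L₁.1 ⊆ F.limitSet L₂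

/-- `L₁ < L₂` if and only if `L₁ ≤ L₂` and `L₁ ≠ L₂`. -/
def LeafLT (F : SmoothFoliation k n M) (L₁ L₂ : F.Leaf) : Prop := F.LeafLE L₁ L₂ ∧ L₁ ≠ L₂

/-- There are leaves `L₁ < L₂ < ⋯ < L_{m+1} = L`. -/
def HasChain (F : SmoothFoliation k n M) (L : F.Leaf) (m : ℕ) : Prop :=
  ∃ c : Fin (m + 1) → F.Leaf,
    (∀ i : Fin m, F.LeafLT (c i.castSucc) (c i.succ)) ∧ c (Fin.last m) = L

/-- The depth `d(L) ∈ {1, 2, …, ∞}`: the supremum of the numbers `r` of leaves in chains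
`L₁ < L₂ < ⋯ < L_r = L`. -/
noncomputable def depth (F : SmoothFoliation k n M) (L : F.Leaf) : ℕ∞ :=
  ⨆ (m : ℕ) (_ : F.HasChain L m), ((m + 1 : ℕ) : ℕ∞)

/-- `v` is tangent at `p` to the leaf through `p`: in foliated charts around `p`, its last `n - k`
components vanish. -/
def IsTangent (F : SmoothFoliation k n M) (p : M) (v : TangentSpace (𝓡 n) p) : Prop :=
  ∀ φ : OpenPartialHomeomorph M (EuclideanSpace ℝ (Fin n)), IsFoliatedChart k F.leaves φ →
    p ∈ φ.source → ∀ j : Fin n, k ≤ (j : ℕ) →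
      EuclideanSpace.proj (𝕜 := ℝ) j (mfderiv (𝓡 n) 𝓘(ℝ, EuclideanSpace ℝ (Fin n)) φ p v) = 0

end SmoothFoliation

/-- A codimension-one foliation is transversely oriented if there is a smooth vector field on `M`
that is nowhere tangent to the leaves (in particular it vanishes nowhere). -/
def SmoothFoliation.IsTransverselyOriented {n : ℕ} {M : Type*} [TopologicalSpace M]
    [ChartedSpace (EuclideanSpace ℝ (Fin (n + 1))) M] [IsManifold (𝓡 (n + 1)) ∞ M]
    (F : SmoothFoliation n (n + 1) M) : Prop :=
  ∃ X : (p : M) → TangentSpace (𝓡 (n + 1)) p,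
    ContMDiff (𝓡 (n + 1)) (𝓡 (n + 1)).tangent ∞
      (fun p => (⟨p, X p⟩ : TangentBundle (𝓡 (n + 1)) M)) ∧
    ∀ p : M, ¬ F.IsTangent p (X p)

/-! Let `C` be the family of leaves of depth at most `d`. A leaf has depth at most `d + 1` exactly
when every other leaf in its closure belongs to `C`. Hence, if the union of `C` is closed, the
leaves of depth `d + 1` are those outside `C` that become closed together with `C`, the family
`relClosed`. Both claims reduce to statements about such a closed `C`. For (b), adding `relClosed`
to `C` gives a closed set again (`mem_relClosed_of_mem_closure`), and induction on `d` applies. For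
(a), a leaf outside `C` accumulates on a bounded number of leaves of `relClosed`
(`card_le_of_subset_closure`).

Cover `M` by finitely many boxes such that a transverse segment shorter than `eps` can be carried
from a box into any overlapping one. The vector field makes these transitions increasing, so "above"
has a global meaning. If the gaps between a leaf and the leaf `K` below it always have length less
than `eps`, then being directly above `K` at one place propagates along the whole leaf
(`above_of_direct`). Gaps are controlled by finitely many marker heights, dense up to `eps` in every
box. In a family `C ∪ J` with `J` finite, a leaf that is not the last one below any marker has only
thin gaps above it, and the number of leaves of `J` owning a marker is bounded independently of `J`.

For (a): if a leaf accumulates on all of `J`, it runs directly above or directly below every member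
of `J` that owns no marker in either orientation. It can do so for at most one member on each side.

For (b): suppose leaves of `relClosed` accumulate at `x`, while the leaf of `x` has a further limit
point `z` outside `C`. Choose `J` with the most marker owners. A new leaf close to `x` cannot raise
their number, which forces it to run directly above or below a fixed `K` for infinitely many
approximations. Near `z` such a leaf would have two plaques in a slab free of `K`, both directly
above (or below) `K`. This is impossible by `eq_of_above`. -/

open Set Filter in
/-- A finite system of boxes for a codimension-one foliation whose leaves are the fibres of `ℓ`.
Each box has a height function, constant on plaques, and an axis meeting the plaque of height `t`
in the point `axis a t`. Where two boxes overlap, heights correspond increasingly, uniformly on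
intervals of radius `eps`, and leaves are generated by the plaques of the cores of the boxes. -/
structure TransverseAtlas {M Λ : Type*} [TopologicalSpace M] (ℓ : M → Λ) (ι : Type*) where
  eps : ℝ
  eps_pos : 0 < eps
  eps_le : eps ≤ 1
  core : ι → Set M
  mid : ι → Set M
  height : ι → M → ℝ
  axis : ι → ℝ → M
  isOpen_core : ∀ a, IsOpen (core a)
  exists_core : ∀ p, ∃ a, p ∈ core a
  core_subset_mid : ∀ a, core a ⊆ mid a
  continuousOn_height : ∀ a, ContinuousOn (height a) (core a)
  abs_height : ∀ a, ∀ p ∈ core a, |height a p| < 1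
  continuousOn_axis : ∀ a, ContinuousOn (axis a) (Ioo (-3) 3)
  axis_mem_mid : ∀ a t, |t| < 2 → axis a t ∈ mid a
  height_axis : ∀ a t, |t| < 2 → height a (axis a t) = t
  leaf_axis : ∀ a, ∀ p ∈ core a, ℓ (axis a (height a p)) = ℓ p
  eventually_height : ∀ a, ∀ p ∈ core a, ∀ W ∈ 𝓝 p,
    ∀ᶠ t in 𝓝 (height a p), ∃ r ∈ W, r ∈ core a ∧ height a r = t
  switch : ∀ a b, ∀ r ∈ mid a, r ∈ core b → ∃ f : ℝ → ℝ,
    ContinuousOn f (Ioo (height a r - eps) (height a r + eps)) ∧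
    StrictMonoOn f (Ioo (height a r - eps) (height a r + eps)) ∧
    f (height a r) = height b r ∧
    ∀ s ∈ Ioo (height a r - eps) (height a r + eps),
      |f s| < 2 ∧ ℓ (axis b (f s)) = ℓ (axis a s)
  leaf_chain : ∀ p q, ℓ p = ℓ q →
    Relation.EqvGen (fun p q => ∃ a, p ∈ core a ∧ q ∈ core a ∧ height a p = height a q) p q

namespace TransverseAtlas

open Set Filter

variable {M Λ ι : Type*} [TopologicalSpace M] {ℓ : M → Λ}

/-- The leaf through the point of height `t` on the axis of the box `a`. -/
def lab (A : TransverseAtlas ℓ ι) (a : ι) (t : ℝ) : Λ := ℓ (A.axis a t)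

/-- The same boxes with the transverse orientation reversed. -/
def rev (A : TransverseAtlas ℓ ι) : TransverseAtlas ℓ ι where
  eps := A.eps
  eps_pos := A.eps_pos
  eps_le := A.eps_le
  core := A.core
  mid := A.mid
  height a p := -A.height a p
  axis a t := A.axis a (-t)
  isOpen_core := A.isOpen_core
  exists_core := A.exists_core
  core_subset_mid := A.core_subset_mid
  continuousOn_height a := (A.continuousOn_height a).neg
  abs_height a p hp := by rw [abs_neg]; exact A.abs_height a p hp
  continuousOn_axis a := (A.continuousOn_axis a).comp continuous_neg.continuousOn
    (fun t ht => ⟨by linarith [ht.2], by linarith [ht.1]⟩)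
  axis_mem_mid a t ht := A.axis_mem_mid a _ (by rwa [abs_neg])
  height_axis a t ht := by rw [A.height_axis a _ (by rwa [abs_neg]), neg_neg]
  leaf_axis a p hp := by rw [neg_neg]; exact A.leaf_axis a p hp
  eventually_height a p hp W hW := by
    have h := A.eventually_height a p hp W hW
    have hc : Tendsto (fun t : ℝ => -t) (𝓝 (-A.height a p)) (𝓝 (A.height a p)) := by
      simpa using (continuous_neg.tendsto (-A.height a p))
    filter_upwards [hc.eventually h] with t ht
    obtain ⟨r, h1, h2, h3⟩ := ht
    exact ⟨r, h1, h2, by rw [h3, neg_neg]⟩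
  switch a b r hr hb := by
    obtain ⟨f, f1, f2, f3, f4⟩ := A.switch a b r hr hb
    have hm : ∀ s ∈ Ioo (-A.height a r - A.eps) (-A.height a r + A.eps),
        -s ∈ Ioo (A.height a r - A.eps) (A.height a r + A.eps) :=
      fun s hs => ⟨by linarith [hs.2], by linarith [hs.1]⟩
    refine ⟨fun s => -f (-s), (f1.comp continuous_neg.continuousOn hm).neg, ?_, ?_, ?_⟩
    · intro s hs t ht hst
      have := f2 (hm t ht) (hm s hs) (neg_lt_neg hst)
      exact neg_lt_neg this
    · simp only [neg_neg, f3]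
    · intro s hs
      obtain ⟨h1, h2⟩ := f4 _ (hm s hs)
      exact ⟨by rwa [abs_neg], by rw [neg_neg]; exact h2⟩
  leaf_chain p q h := by
    have := A.leaf_chain p q h
    simpa only [neg_inj] using this

theorem rev_lab (A : TransverseAtlas ℓ ι) (a : ι) (t : ℝ) : A.rev.lab a t = A.lab a (-t) := rfl

theorem rev_height (A : TransverseAtlas ℓ ι) (a : ι) (p : M) :
    A.rev.height a p = -A.height a p := rfl

/-! ### Holonomy along leaves and closed saturated sets -/

section Saturation

variable (A : TransverseAtlas ℓ ι)
include A

theorem leaf_eq_of_height_eq {a : ι} {p q : M} (hp : p ∈ A.core a) (hq : q ∈ A.core a)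
    (h : A.height a p = A.height a q) : ℓ p = ℓ q := by
  rw [← A.leaf_axis a p hp, h, A.leaf_axis a q hq]

theorem lab_height {a : ι} {p : M} (hp : p ∈ A.core a) : A.lab a (A.height a p) = ℓ p :=
  A.leaf_axis a p hp

/-- This replaces transport along paths in a leaf: by `leaf_chain` it is enough to move within one
plaque of one core at a time. -/
theorem leaf_induction {P : M → Prop}
    (hP : ∀ a p q, p ∈ A.core a → q ∈ A.core a → A.height a p = A.height a q → P p → P q)
    {p q : M} (h : ℓ p = ℓ q) (hp : P p) : P q := by
  have hc := A.leaf_chain p q h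
  have key : P p ↔ P q := by
    clear hp h
    induction hc with
    | rel p q h =>
      obtain ⟨a, h1, h2, h3⟩ := h
      exact ⟨hP a p q h1 h2 h3, hP a q p h2 h1 h3.symm⟩
    | refl => exact Iff.rfl
    | symm p q _ ih => exact ih.symm
    | trans p q r _ _ ih1 ih2 => exact ih1.trans ih2
  exact key.1 hp

theorem continuousAt_height {a : ι} {p : M} (hp : p ∈ A.core a) :
    ContinuousAt (A.height a) p :=
  (A.continuousOn_height a).continuousAt ((A.isOpen_core a).mem_nhds hp)

/-- The saturation of a neighbourhood is a neighbourhood of every point of a leaf it meets. -/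
theorem eventually_exists_leaf_eq {x q : M} (h : ℓ x = ℓ q) {W : Set M} (hW : W ∈ 𝓝 q) :
    ∀ᶠ r in 𝓝 x, ∃ r' ∈ W, ℓ r' = ℓ r := by
  refine A.leaf_induction (P := fun y => ∀ᶠ r in 𝓝 y, ∃ r' ∈ W, ℓ r' = ℓ r) ?_ h.symm ?_
  · intro a p y hp hy hpy H
    have h1 := A.eventually_height a p hp _ H
    rw [hpy] at h1
    filter_upwards [(A.continuousAt_height hy).eventually h1, (A.isOpen_core a).mem_nhds hy]
      with r ⟨r1, ⟨r', hr', e'⟩, hr1, e1⟩ hr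
    exact ⟨r', hr', e'.trans (A.leaf_eq_of_height_eq hr1 hr e1)⟩
  · filter_upwards [hW] with r hr using ⟨r, hr, rfl⟩

theorem mem_closure_of_leaf_eq {S : Set Λ} {p q : M} (h : ℓ p = ℓ q)
    (hp : p ∈ closure (ℓ ⁻¹' S)) : q ∈ closure (ℓ ⁻¹' S) := by
  rw [mem_closure_iff_nhds]
  intro W hW
  obtain ⟨r, ⟨r', h1, h2⟩, h3⟩ := mem_closure_iff_nhds.1 hp _ (A.eventually_exists_leaf_eq h hW)
  exact ⟨r', h1, by rw [mem_preimage, h2]; exact h3⟩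

theorem isCompact_lab {E : Set Λ} (hE : IsClosed (ℓ ⁻¹' E)) (a : ι) {u v : ℝ} (hu : -3 < u)
    (hv : v < 3) : IsCompact (Icc u v ∩ {s | A.lab a s ∈ E}) := by
  have h1 : ContinuousOn (A.axis a) (Icc u v) :=
    (A.continuousOn_axis a).mono fun t ht => ⟨by linarith [ht.1], by linarith [ht.2]⟩
  exact isCompact_Icc.of_isClosed_subset (h1.preimage_isClosed_of_isClosed isClosed_Icc hE)
    inter_subset_left

theorem exists_last {E : Set Λ} (hE : IsClosed (ℓ ⁻¹' E)) (a : ι) {u v : ℝ} (hu : -3 < u)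
    (hv : v < 3) (huv : u ≤ v) (h : A.lab a u ∈ E) :
    ∃ c, u ≤ c ∧ c ≤ v ∧ A.lab a c ∈ E ∧ ∀ s ∈ Ioc c v, A.lab a s ∉ E := by
  obtain ⟨c, hc, hmax⟩ := (A.isCompact_lab hE a hu hv).exists_isGreatest ⟨u, ⟨le_rfl, huv⟩, h⟩
  refine ⟨c, hc.1.1, hc.1.2, hc.2, fun s hs hsE => ?_⟩
  exact absurd (hmax ⟨⟨hc.1.1.trans hs.1.le, hs.2⟩, hsE⟩) (not_le.2 hs.1)

theorem exists_first {E : Set Λ} (hE : IsClosed (ℓ ⁻¹' E)) (a : ι) {u v : ℝ} (hu : -3 < u)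
    (hv : v < 3) (huv : u ≤ v) (h : A.lab a v ∈ E) :
    ∃ c, u ≤ c ∧ c ≤ v ∧ A.lab a c ∈ E ∧ ∀ s ∈ Ico u c, A.lab a s ∉ E := by
  obtain ⟨c, hc, hmin⟩ := (A.isCompact_lab hE a hu hv).exists_isLeast ⟨v, ⟨huv, le_rfl⟩, h⟩
  refine ⟨c, hc.1.1, hc.1.2, hc.2, fun s hs hsE => ?_⟩
  exact absurd (hmin ⟨⟨hs.1, hs.2.le.trans hc.1.2⟩, hsE⟩) (not_le.2 hs.2)

end Saturation

/-! ### Leaves running directly above another leaf -/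

/-- Below height `t` in the box `a`, the first leaf of the family `E` is `K`, at distance less than
`eps`. -/
def Direct (A : TransverseAtlas ℓ ι) (E : Set Λ) (K : Λ) (a : ι) (t : ℝ) : Prop :=
  ∃ c, t - A.eps < c ∧ c < t ∧ A.lab a c = K ∧ ∀ s ∈ Ioo c t, A.lab a s ∉ E

/-- The leaf `b` runs everywhere directly above the leaf `K` of the family `E`, at distance less
than `eps`. -/
def Above (A : TransverseAtlas ℓ ι) (E : Set Λ) (b K : Λ) : Prop :=
  ∀ a, ∀ q ∈ A.core a, ℓ q = b → A.Direct E K a (A.height a q)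

theorem Above.mono {A : TransverseAtlas ℓ ι} {E E' : Set Λ} {b K : Λ} (h : A.Above E' b K)
    (hE : E ⊆ E') : A.Above E b K := by
  intro a q hq hb
  obtain ⟨c, h1, h2, h3, h4⟩ := h a q hq hb
  exact ⟨c, h1, h2, h3, fun s hs hsE => h4 s hs (hE hsE)⟩

theorem eq_of_free (A : TransverseAtlas ℓ ι) {E : Set Λ} {a : ι} {t c c' : ℝ} (hc : c < t) (hc' : c' < t)
    (h : A.lab a c ∈ E) (h' : A.lab a c' ∈ E) (f : ∀ s ∈ Ioo c t, A.lab a s ∉ E)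
    (f' : ∀ s ∈ Ioo c' t, A.lab a s ∉ E) : c = c' := by
  rcases lt_trichotomy c c' with h1 | h1 | h1
  · exact absurd h' (f _ ⟨h1, hc'⟩)
  · exact h1
  · exact absurd h (f' _ ⟨h1, hc⟩)

theorem Above.unique {A : TransverseAtlas ℓ ι} {E : Set Λ} {q : M} {K K' : Λ}
    (h : A.Above E (ℓ q) K) (h' : A.Above E (ℓ q) K') (hK : K ∈ E) (hK' : K' ∈ E) : K = K' := by
  obtain ⟨a, ha⟩ := A.exists_core q
  obtain ⟨c, h1, h2, h3, h4⟩ := h a q ha rfl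
  obtain ⟨c', h1', h2', h3', h4'⟩ := h' a q ha rfl
  rw [← h3, ← h3', A.eq_of_free h2 h2' (h3 ▸ hK) (h3' ▸ hK') h4 h4']

/-- The gap lies in the window of radius `eps` on which heights correspond increasingly and leaf by
leaf, so it is mapped onto the gap in the new box. Its length may grow beyond `eps`; only the bound
`-2` survives, and thinness has to come from elsewhere. -/
theorem Direct.switch {A : TransverseAtlas ℓ ι} {E : Set Λ} {K : Λ} {a b : ι} {r : M}
    (hr : r ∈ A.mid a) (hb : r ∈ A.core b) (h : A.Direct E K a (A.height a r)) :
    ∃ c, -2 < c ∧ c < A.height b r ∧ A.lab b c = K ∧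
      ∀ s ∈ Ioo c (A.height b r), A.lab b s ∉ E := by
  obtain ⟨f, f1, f2, f3, f4⟩ := A.switch a b r hr hb
  obtain ⟨c, h1, h2, h3, h4⟩ := h
  have hε := A.eps_pos
  have hcm : c ∈ Ioo (A.height a r - A.eps) (A.height a r + A.eps) := ⟨h1, by linarith⟩
  have hrm : A.height a r ∈ Ioo (A.height a r - A.eps) (A.height a r + A.eps) :=
    ⟨by linarith, by linarith⟩
  refine ⟨f c, (abs_lt.1 (f4 c hcm).1).1, f3 ▸ f2 hcm hrm h2, (f4 c hcm).2.trans h3, ?_⟩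
  intro s hs
  rw [← f3] at hs
  have hsub : Icc c (A.height a r) ⊆ Ioo (A.height a r - A.eps) (A.height a r + A.eps) :=
    fun t ht => ⟨by linarith [ht.1], by linarith [ht.2]⟩
  obtain ⟨t, ht, rfl⟩ := intermediate_value_Ioo h2.le (f1.mono hsub) hs
  have := h4 t ht
  rwa [lab, (f4 t (hsub ⟨ht.1.le, ht.2.le⟩)).2]

/-- If the gaps between the leaf `L` and the leaf `K` of `E` directly below it are always small,
then `L` stays directly above `K` once it is so at one point. -/
theorem above_of_direct (A : TransverseAtlas ℓ ι) {E : Set Λ} {K : Λ} {r : M} {a : ι}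
    (thin : ∀ a, ∀ q ∈ A.core a, ℓ q = ℓ r → ∀ c, -2 < c → c < A.height a q → A.lab a c = K →
      (∀ s ∈ Ioo c (A.height a q), A.lab a s ∉ E) → A.height a q - A.eps < c)
    (hr : r ∈ A.mid a) (hd : A.Direct E K a (A.height a r)) : A.Above E (ℓ r) K := by
  have step : ∀ a b q, ℓ q = ℓ r → q ∈ A.mid a → q ∈ A.core b →
      A.Direct E K a (A.height a q) → A.Direct E K b (A.height b q) := by
    intro a b q hq ha hb h
    obtain ⟨c, h1, h2, h3, h4⟩ := h.switch ha hb
    exact ⟨c, thin b q hb hq c h1 h2 h3 h4, h2, h3, h4⟩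
  intro b q hb hq
  have := A.leaf_induction (P := fun p => ∀ b, ℓ p = ℓ r → p ∈ A.core b →
    A.Direct E K b (A.height b p)) ?_ hq.symm ?_
  · exact this b hq hb
  · intro a p q hp hq hpq H b hqr hqb
    refine step a b q hqr (A.core_subset_mid a hq) hqb ?_
    rw [← hpq]
    exact H a ((A.leaf_eq_of_height_eq hp hq hpq).trans hqr) hp
  · exact fun b _ hb => step a b r rfl hr hb hd

/-- The leaves outside the family `C` that are closed in the complement of `C`. -/
def relClosed (ℓ : M → Λ) (C : Set Λ) : Set Λ := {K | K ∉ C ∧ IsClosed (ℓ ⁻¹' insert K C)}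

theorem isClosed_union_relClosed {C : Set Λ} (hC : IsClosed (ℓ ⁻¹' C)) (J : Finset Λ)
    (hJ : ∀ K ∈ J, K ∈ relClosed ℓ C) : IsClosed (ℓ ⁻¹' (C ∪ J)) := by
  classical
  induction J using Finset.induction_on with
  | empty => simpa using hC
  | insert K J _ ih =>
    have h1 := (hJ K (Finset.mem_insert_self K J)).2
    have h2 := ih fun K' h => hJ K' (Finset.mem_insert_of_mem h)
    have : C ∪ ↑(insert K J) = insert K C ∪ (C ∪ ↑J) := by
      ext x; simp only [Finset.coe_insert, mem_union, mem_insert_iff, Finset.mem_coe]; tauto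
    rw [this, preimage_union]
    exact h1.union h2

/-- A leaf `b` cannot run directly above `K` and accumulate in two nearby plaques of the
same slab. -/
theorem eq_of_above {A : TransverseAtlas ℓ ι} {C E : Set Λ} (hCE : C ⊆ E) {K : Λ} (hKE : K ∈ E)
    (hKC : K ∉ C) {a : ι} {q q' : M} (hq : q ∈ A.core a) (hq' : q' ∈ A.core a) (hqq : ℓ q' = ℓ q)
    (hb : IsClosed (ℓ ⁻¹' insert (ℓ q) C)) (hbK : ℓ q ≠ K) (hA : A.Above E (ℓ q) K)
    (hfree : ∀ s ∈ Icc (A.height a q') (A.height a q), A.lab a s ≠ K) :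
    A.height a q ≤ A.height a q' := by
  by_contra! hlt
  obtain ⟨c, h1, h2, h3, h4⟩ := hA a q hq rfl
  obtain ⟨c', h1', h2', h3', h4'⟩ := hA a q' hq' hqq
  have hcq : c < A.height a q' := by
    by_contra! hc
    exact hfree c ⟨hc, h2.le⟩ h3
  have hcc : c = c' := by
    refine A.eq_of_free hcq h2' (h3 ▸ hKE) (h3' ▸ hKE) (fun s hs => h4 s ⟨hs.1, ?_⟩) h4'
    exact hs.2.trans hlt
  subst hcc
  have hε := A.eps_le
  have hq1 := abs_lt.1 (A.abs_height a q hq)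
  have hq1' := abs_lt.1 (A.abs_height a q' hq')
  -- Both plaques of the leaf lie above the same plaque of `K`, at height `c`. Take the lowest
  -- plaque of the leaf above `c`: nothing of the leaf itself lies between, so from here it runs
  -- above `K` even relative to the family enlarged by itself.
  obtain ⟨m, m1, m2, m3, m4⟩ := A.exists_first hb a (u := c) (v := A.height a q') (by linarith)
    (by linarith) hcq.le (by rw [A.lab_height hq', hqq]; exact mem_insert _ _)
  have hcm : c < m := by
    refine lt_of_le_of_ne m1 ?_
    rintro rfl
    rw [h3] at m3
    rcases m3 with h | h
    · exact hbK h.symm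
    · exact hKC h
  have hmC : A.lab a m = ℓ q := by
    rcases m3 with h | h
    · exact h
    · exact absurd (hCE h) (h4 m ⟨hcm, m2.trans_lt hlt⟩)
  have hm2 : |m| < 2 := abs_lt.2 ⟨by linarith, by linarith⟩
  have hab : A.Above (insert (ℓ q) E) (ℓ (A.axis a m)) K := by
    refine A.above_of_direct ?_ (A.axis_mem_mid a m hm2) ?_
    · intro a1 q1 hq1 hl1 c1 _ hc1 hK1 hf1
      obtain ⟨c2, h5, h6, h7, h8⟩ := hA a1 q1 hq1 (hl1.trans hmC)
      have := A.eq_of_free hc1 h6 (hK1 ▸ hKE) (h7 ▸ hKE)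
        (fun s hs hs' => hf1 s hs (mem_insert_of_mem _ hs')) h8
      rwa [this]
    · rw [A.height_axis a m hm2]
      refine ⟨c, by linarith, hcm, h3, fun s hs => ?_⟩
      rintro (h | h)
      · exact m4 s ⟨hs.1.le, hs.2⟩ (h ▸ mem_insert _ _)
      · exact h4 s ⟨hs.1, by linarith [hs.2]⟩ h
  change A.Above _ (A.lab a m) K at hab
  rw [hmC] at hab
  -- Read at `q`, this stronger property puts `K` at or above the height of `q'`, inside the slab
  -- assumed free of `K`.
  obtain ⟨c3, h9, h10, h11, h12⟩ := hab a q hq rfl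
  have h13 : A.height a q' ≤ c3 := by
    by_contra! h
    refine h12 _ ⟨h, hlt⟩ ?_
    rw [A.lab_height hq', hqq]
    exact mem_insert _ _
  exact hfree c3 ⟨h13, h10.le⟩ h11

/-- If leaves directly above `K` accumulate at `x`, then the leaf of `x` is closed outside `C`
and `K`. -/
theorem false_of_frequently_above {A : TransverseAtlas ℓ ι} {C E : Set Λ} (hCE : C ⊆ E) {K : Λ}
    (hKE : K ∈ E) (hK : K ∈ relClosed ℓ C) {x z : M}
    (hx : ∃ᶠ r in 𝓝 x, ℓ r ∈ relClosed ℓ C ∧ ℓ r ≠ K ∧ A.Above E (ℓ r) K)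
    (hz : z ∈ closure (ℓ ⁻¹' {ℓ x})) (hzC : ℓ z ∉ C) (hzK : ℓ z ≠ K) (hzx : ℓ z ≠ ℓ x) :
    False := by
  obtain ⟨a, ha⟩ := A.exists_core z
  have hz1 := abs_lt.1 (A.abs_height a z ha)
  have hax : ContinuousAt (A.axis a) (A.height a z) :=
    (A.continuousOn_axis a).continuousAt (Ioo_mem_nhds (by linarith) (by linarith))
  have hO : (ℓ ⁻¹' insert K C)ᶜ ∈ 𝓝 (A.axis a (A.height a z)) := by
    refine hK.2.isOpen_compl.mem_nhds ?_
    rw [mem_compl_iff, mem_preimage, A.leaf_axis a z ha]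
    simp [hzC, hzK]
  obtain ⟨η, hη, hball⟩ := Metric.mem_nhds_iff.1 (hax hO)
  have hfree : ∀ s, |s - A.height a z| < η → A.lab a s ≠ K := by
    intro s hs h
    have : s ∈ Metric.ball (A.height a z) η := by rwa [Metric.mem_ball, Real.dist_eq]
    exact hball this (Or.inl h)
  have near : ∀ δ > 0, ∃ p ∈ A.core a, ℓ p = ℓ x ∧ |A.height a p - A.height a z| < δ := by
    intro δ hδ
    have h1 : ∀ᶠ p in 𝓝 z, p ∈ A.core a ∧ |A.height a p - A.height a z| < δ := by
      filter_upwards [(A.isOpen_core a).mem_nhds ha,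
        (A.continuousAt_height ha) (Metric.ball_mem_nhds _ hδ)] with p h1 h2
      exact ⟨h1, by rwa [mem_preimage, Metric.mem_ball, Real.dist_eq] at h2⟩
    obtain ⟨p, ⟨h2, h3⟩, h4⟩ := mem_closure_iff_nhds.1 hz _ h1
    exact ⟨p, h2, h4, h3⟩
  obtain ⟨p, hp, hpx, hpη⟩ := near η hη
  have hpz : A.height a p ≠ A.height a z := fun h =>
    hzx ((A.leaf_eq_of_height_eq hp ha h).symm.trans hpx)
  -- The second plaque of the leaf of `x` is chosen strictly closer to `z` than the first, so the
  -- two heights differ. Holonomy then gives every leaf passing close enough to `x` two plaques near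
  -- these heights.
  obtain ⟨p', hp', hpx', hpη'⟩ := near _ (abs_pos.2 (sub_ne_zero.2 hpz))
  have hpp : A.height a p' ≠ A.height a p := by
    rintro h
    rw [h] at hpη'
    exact lt_irrefl _ hpη'
  have nb : ∀ p ∈ A.core a, |A.height a p - A.height a z| < η → ∀ δ > 0,
      ∀ᶠ r in 𝓝 p, r ∈ A.core a ∧ |A.height a r - A.height a z| < η ∧
        |A.height a r - A.height a p| < δ := by
    intro p hp hpη δ hδ
    have hc := A.continuousAt_height hp
    filter_upwards [(A.isOpen_core a).mem_nhds hp, hc (Metric.ball_mem_nhds _ hδ),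
      (hc.sub continuousAt_const).abs.eventually_lt_const hpη] with r h1 h2 h3
    exact ⟨h1, h3, by rwa [mem_preimage, Metric.mem_ball, Real.dist_eq] at h2⟩
  set δ := |A.height a p' - A.height a p| / 2 with hδ
  have hδ0 : 0 < δ := half_pos (abs_pos.2 (sub_ne_zero.2 hpp))
  have e1 := A.eventually_exists_leaf_eq hpx.symm (nb p hp hpη δ hδ0)
  have e2 := A.eventually_exists_leaf_eq hpx'.symm (nb p' hp' (hpη'.trans hpη) δ hδ0)
  obtain ⟨r, ⟨hr1, hr2, hr3⟩, ⟨q, ⟨hq, hqη, hqp⟩, hqr⟩, ⟨q', ⟨hq', hqη', hqp'⟩, hqr'⟩⟩ :=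
    (hx.and_eventually (e1.and e2)).exists
  have hne : A.height a q ≠ A.height a q' := by
    intro h
    have h5 : |A.height a p' - A.height a p| ≤ |A.height a q' - A.height a p'| +
        |A.height a q - A.height a p| := by
      rw [h, abs_sub_comm (A.height a q') (A.height a p')]
      exact abs_sub_le _ _ _
    linarith
  have main : ∀ q q', q ∈ A.core a → q' ∈ A.core a → ℓ q = ℓ r → ℓ q' = ℓ r →
      |A.height a q - A.height a z| < η → |A.height a q' - A.height a z| < η →
      A.height a q ≤ A.height a q' := by
    intro q q' hq hq' hqr hqr' hqη hqη'
    refine eq_of_above hCE hKE hK.1 hq hq' (hqr'.trans hqr.symm) (hqr ▸ hr1.2) (hqr ▸ hr2)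
      (hqr ▸ hr3) fun s hs => hfree s ?_
    rw [abs_lt] at hqη hqη' ⊢
    exact ⟨by linarith [hs.1], by linarith [hs.2]⟩
  exact hne (le_antisymm (main q q' hq hq' hqr hqr' hqη hqη')
    (main q' q hq' hq hqr' hqr hqη' hqη))

end TransverseAtlas

/-! ### Markers and the leaves that own them -/

open Set Filter in
theorem exists_finset_grid {ε : ℝ} (hε : 0 < ε) : ∃ T : Finset ℝ, (∀ t ∈ T, -2 ≤ t ∧ t ≤ 1) ∧
    ∀ c, -2 ≤ c → c ≤ 1 → ∃ t ∈ T, c ≤ t ∧ t < c + ε := by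
  obtain ⟨N, hN⟩ := exists_nat_gt (3 / (ε / 2))
  have h2 : 0 < ε / 2 := half_pos hε
  -- The spacing `ε / 2` leaves room for rounding up; truncation at `1` keeps the markers in the
  -- required range.
  refine ⟨(Finset.range (N + 2)).image fun j : ℕ => min 1 (-2 + j * (ε / 2)), ?_, ?_⟩
  · intro t ht
    obtain ⟨j, -, rfl⟩ := Finset.mem_image.1 ht
    refine ⟨le_min (by norm_num) ?_, min_le_left _ _⟩
    have : (0 : ℝ) ≤ j * (ε / 2) := by positivity
    linarith
  · intro c hc hc1
    have h0 : 0 ≤ (c + 2) / (ε / 2) := div_nonneg (by linarith) h2.le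
    have h3 : (c + 2) / (ε / 2) ≤ 3 / (ε / 2) := by gcongr; linarith
    have h4 := Nat.le_ceil ((c + 2) / (ε / 2))
    have h5 := Nat.ceil_lt_add_one h0
    refine ⟨_, Finset.mem_image.2 ⟨⌈(c + 2) / (ε / 2)⌉₊, ?_, rfl⟩, le_min hc1 ?_, ?_⟩
    · rw [Finset.mem_range]
      have : (⌈(c + 2) / (ε / 2)⌉₊ : ℝ) < ((N + 2 : ℕ) : ℝ) := by push_cast; linarith
      exact_mod_cast this
    · rw [div_le_iff₀ h2] at h4; linarith
    · refine (min_le_right _ _).trans_lt ?_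
      have h6 : (⌈(c + 2) / (ε / 2)⌉₊ : ℝ) * (ε / 2) < ((c + 2) / (ε / 2) + 1) * (ε / 2) := by
        gcongr
      rw [add_mul, div_mul_cancel₀ _ h2.ne'] at h6
      linarith

namespace TransverseAtlas

open Set Filter

variable {M Λ ι : Type*} [TopologicalSpace M] {ℓ : M → Λ}

/-- A finite set of heights meeting every interval of length `eps` in `[-2, 1]`. -/
noncomputable def markers (A : TransverseAtlas ℓ ι) : Finset ℝ :=
  (exists_finset_grid A.eps_pos).choose

theorem mem_markers (A : TransverseAtlas ℓ ι) {t : ℝ} (ht : t ∈ A.markers) : -2 ≤ t ∧ t ≤ 1 :=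
  (exists_finset_grid A.eps_pos).choose_spec.1 t ht

theorem exists_marker (A : TransverseAtlas ℓ ι) {c : ℝ} (hc : -2 ≤ c) (hc1 : c ≤ 1) :
    ∃ t ∈ A.markers, c ≤ t ∧ t < c + A.eps :=
  (exists_finset_grid A.eps_pos).choose_spec.2 c hc hc1

/-- `K` is the leaf of the family `E` directly below (or at) height `t` in the box `a`. -/
def LastBelow (A : TransverseAtlas ℓ ι) (E : Set Λ) (K : Λ) (a : ι) (t : ℝ) : Prop :=
  ∃ c, -2 ≤ c ∧ c ≤ t ∧ A.lab a c = K ∧ ∀ s ∈ Ioc c t, A.lab a s ∉ E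

/-- `K` is the leaf of the family `E` directly below some marker. -/
def Marked (A : TransverseAtlas ℓ ι) (E : Set Λ) (K : Λ) : Prop :=
  ∃ a, ∃ t ∈ A.markers, A.LastBelow E K a t

theorem LastBelow.unique {A : TransverseAtlas ℓ ι} {E : Set Λ} {K K' : Λ} {a : ι} {t : ℝ}
    (h : A.LastBelow E K a t) (h' : A.LastBelow E K' a t) (hK : K ∈ E) (hK' : K' ∈ E) :
    K = K' := by
  obtain ⟨c, -, h2, rfl, h4⟩ := h
  obtain ⟨c', -, h2', rfl, h4'⟩ := h'
  rcases lt_trichotomy c c' with h1 | rfl | h1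
  · exact absurd hK' (h4 _ ⟨h1, h2'⟩)
  · rfl
  · exact absurd hK (h4' _ ⟨h1, h2⟩)

/-- Some marker lies less than `eps` above the plaque of `K`. As `K` is not last below it, a plaque
of `E` intervenes. -/
theorem exists_above_of_not_marked {A : TransverseAtlas ℓ ι} {E : Set Λ} {K : Λ}
    (h : ¬ A.Marked E K) {a : ι} {c : ℝ} (hc : -2 ≤ c) (hc1 : c ≤ 1) (hK : A.lab a c = K) :
    ∃ s, c < s ∧ s < c + A.eps ∧ A.lab a s ∈ E := by
  obtain ⟨t, ht, h1, h2⟩ := A.exists_marker hc hc1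
  by_contra! hcon
  exact h ⟨a, t, ht, c, hc, h1, hK, fun s hs => hcon s hs.1 (hs.2.trans_lt h2)⟩

theorem thin_of_not_marked {A : TransverseAtlas ℓ ι} {E : Set Λ} {K : Λ}
    (h : ¬ A.Marked E K) {a : ι} {q : M} (hq : q ∈ A.core a) {c : ℝ} (hc : -2 < c)
    (hcq : c < A.height a q) (hK : A.lab a c = K)
    (hf : ∀ s ∈ Ioo c (A.height a q), A.lab a s ∉ E) : A.height a q - A.eps < c := by
  have hq1 := abs_lt.1 (A.abs_height a q hq)
  obtain ⟨s, h1, h2, h3⟩ := exists_above_of_not_marked h hc.le (by linarith) hK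
  have : A.height a q ≤ s := by
    by_contra! h4
    exact hf s ⟨h1, h4⟩ h3
  linarith

/-- The neighbour found lies in `E` itself and is not merely a return of the leaf of `q`: the last
plaque below the marker cannot belong to that leaf, since the leaf is unmarked. -/
theorem exists_near_of_not_marked {A : TransverseAtlas ℓ ι} {E : Set Λ} {q : M}
    (hE : IsClosed (ℓ ⁻¹' insert (ℓ q) E)) (h : ¬ A.Marked (insert (ℓ q) E) (ℓ q)) {a : ι}
    (hq : q ∈ A.core a) :
    ∃ s, A.height a q < s ∧ s < A.height a q + A.eps ∧ A.lab a s ∈ E := by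
  have hq1 := abs_lt.1 (A.abs_height a q hq)
  obtain ⟨t, ht, h1, h2⟩ := A.exists_marker (c := A.height a q) (by linarith) (by linarith)
  by_contra! hcon
  have ht2 := A.mem_markers ht
  obtain ⟨c, h3, h4, h5, h6⟩ := A.exists_last hE a (u := A.height a q) (v := t) (by linarith)
    (by linarith) h1 (by rw [A.lab_height hq]; exact mem_insert _ _)
  refine h ⟨a, t, ht, c, by linarith, h4, ?_, h6⟩
  rcases h5 with h5 | h5
  · exact h5
  · rcases h3.eq_or_lt with h3 | h3
    · rw [← h3, A.lab_height hq]
    · exact absurd h5 (hcon c h3 (h4.trans_lt h2))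

/-- If `K` loses its last marker when the leaf `b` is added to the family, then `b` takes it over
and runs directly above `K`. -/
theorem above_of_marked_of_not_marked {A : TransverseAtlas ℓ ι} {C E : Set Λ} (hCE : C ⊆ E)
    {b K : Λ} (hb : IsClosed (ℓ ⁻¹' insert b C)) (hK : K ∉ insert b C)
    (h : A.Marked E K) (h' : ¬ A.Marked (insert b E) K) :
    A.Above (insert b E) b K ∧ A.Marked (insert b E) b := by
  obtain ⟨a, t, ht, c, hc, hct, hcK, hf⟩ := h
  have ht2 := A.mem_markers ht
  have hex : ∃ s ∈ Ioc c t, A.lab a s ∈ insert b E := by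
    by_contra! hcon
    exact h' ⟨a, t, ht, c, hc, hct, hcK, hcon⟩
  have isb : ∀ s ∈ Ioc c t, A.lab a s ∈ insert b E → A.lab a s = b := fun s hs hsE =>
    hsE.resolve_right (hf s hs)
  have sub : insert b C ⊆ insert b E := insert_subset_insert hCE
  obtain ⟨s, hs, hsE⟩ := hex
  have hsb := isb s hs hsE
  obtain ⟨m, m1, m2, m3, m4⟩ := A.exists_first hb a (u := c) (v := s) (by linarith)
    (by linarith [hs.2]) hs.1.le (hsb ▸ mem_insert _ _)
  have hcm : c < m := lt_of_le_of_ne m1 (by rintro rfl; exact hK (hcK ▸ m3))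
  have hmb : A.lab a m = b := isb m ⟨hcm, m2.trans hs.2⟩ (sub m3)
  have free : ∀ u ∈ Ioo c m, A.lab a u ∉ insert b E := by
    intro u hu huE
    refine m4 u ⟨hu.1.le, hu.2⟩ ?_
    rw [isb u ⟨hu.1, hu.2.le.trans (m2.trans hs.2)⟩ huE]
    exact mem_insert _ _
  constructor
  · have hm2 : |m| < 2 := abs_lt.2 ⟨by linarith, by linarith [hs.2]⟩
    have hab : A.Above (insert b E) (ℓ (A.axis a m)) K := by
      -- Since `K` owns no marker in the enlarged family, all its gaps above are thin, and the
      -- relation propagates.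
      refine A.above_of_direct ?_ (A.axis_mem_mid a m hm2) ?_
      · intro a1 q1 hq1 _ c1 hc1 hcq1 hK1 hf1
        exact thin_of_not_marked h' hq1 hc1 hcq1 hK1 hf1
      · rw [A.height_axis a m hm2]
        refine ⟨c, ?_, hcm, hcK, free⟩
        obtain ⟨u, u1, u2, u3⟩ := exists_above_of_not_marked h' hc (by linarith) hcK
        have : m ≤ u := by
          by_contra! h4
          exact free u ⟨u1, h4⟩ u3
        linarith
    change A.Above _ (A.lab a m) K at hab
    rwa [hmb] at hab
  · obtain ⟨d, d1, d2, d3, d4⟩ := A.exists_last hb a (u := m) (v := t) (by linarith)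
      (by linarith) (m2.trans hs.2) (hmb ▸ mem_insert _ _)
    refine ⟨a, t, ht, d, by linarith, d2, isb d ⟨by linarith, d2⟩ (sub d3), fun u hu huE => ?_⟩
    refine d4 u hu ?_
    rw [isb u ⟨by linarith [hu.1], hu.2⟩ huE]
    exact mem_insert _ _

open Classical in
/-- The leaves of `J` that are directly below a marker, relative to the family `C ∪ J`. -/
noncomputable def markedLeaves (A : TransverseAtlas ℓ ι) (C : Set Λ) (J : Finset Λ) : Finset Λ :=
  J.filter fun K => A.Marked (C ∪ J) K

theorem mem_markedLeaves {A : TransverseAtlas ℓ ι} {C : Set Λ} {J : Finset Λ} {K : Λ} :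
    K ∈ A.markedLeaves C J ↔ K ∈ J ∧ A.Marked (C ∪ J) K := by
  classical
  exact Finset.mem_filter

theorem card_markedLeaves_le [Fintype ι] (A : TransverseAtlas ℓ ι) (C : Set Λ) (J : Finset Λ) :
    (A.markedLeaves C J).card ≤ Fintype.card ι * A.markers.card := by
  classical
  have h : ∀ K ∈ A.markedLeaves C J, ∃ g ∈ (Finset.univ : Finset ι) ×ˢ A.markers,
      A.LastBelow (C ∪ J) K g.1 g.2 := by
    intro K hK
    obtain ⟨-, a, t, ht, h⟩ := mem_markedLeaves.1 hK
    exact ⟨(a, t), Finset.mem_product.2 ⟨Finset.mem_univ _, ht⟩, h⟩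
  have := Finset.card_le_card_of_forall_subsingleton _ h fun g _ K hK K' hK' =>
    hK.2.unique hK'.2 (Or.inr (mem_markedLeaves.1 hK.1).1) (Or.inr (mem_markedLeaves.1 hK'.1).1)
  rwa [Finset.card_product, Finset.card_univ] at this

theorem union_insert_coe [DecidableEq Λ] (C : Set Λ) (J : Finset Λ) (b : Λ) :
    C ∪ ↑(insert b J) = insert b (C ∪ (J : Set Λ)) := by
  ext x
  simp only [Finset.coe_insert, mem_union, mem_insert_iff, Finset.mem_coe]
  tauto

/-- A leaf `K` that loses all its markers loses them to the new leaf, which then runs directly above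
`K`. A leaf runs directly above only one leaf of the family, so at most one owner is lost, and the
new leaf replaces it. If the new leaf owns a marker and nobody is lost, the count strictly grows. -/
theorem card_markedLeaves_insert [DecidableEq Λ] (A : TransverseAtlas ℓ ι) {C : Set Λ}
    {J : Finset Λ} (hJ : ∀ K ∈ J, K ∈ relClosed ℓ C) {q : M} (hb : ℓ q ∈ relClosed ℓ C)
    (hbJ : ℓ q ∉ J) :
    (A.markedLeaves C J).card ≤ (A.markedLeaves C (insert (ℓ q) J)).card ∧
    (A.Marked (C ∪ ↑(insert (ℓ q) J)) (ℓ q) →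
      (A.markedLeaves C J).card < (A.markedLeaves C (insert (ℓ q) J)).card ∨
      ∃ K ∈ J, A.Above (C ∪ J) (ℓ q) K) := by
  set b := ℓ q with hbdef
  have lost : ∀ K ∈ A.markedLeaves C J, K ∉ A.markedLeaves C (insert b J) →
      A.Above (insert b (C ∪ J)) b K ∧ A.Marked (insert b (C ∪ J)) b := by
    intro K hK hK'
    obtain ⟨hKJ, hKm⟩ := mem_markedLeaves.1 hK
    refine above_of_marked_of_not_marked (subset_union_left) hb.2 ?_ hKm ?_
    · rintro (rfl | h)
      · exact hbJ hKJ
      · exact (hJ K hKJ).1 h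
    · intro h
      exact hK' (mem_markedLeaves.2 ⟨Finset.mem_insert_of_mem hKJ, by rwa [union_insert_coe]⟩)
  have hbm : b ∉ A.markedLeaves C J := fun h => hbJ (mem_markedLeaves.1 h).1
  by_cases hsub : A.markedLeaves C J ⊆ A.markedLeaves C (insert b J)
  · refine ⟨Finset.card_le_card hsub, fun hm => Or.inl (Finset.card_lt_card ?_)⟩
    refine ⟨hsub, fun h => hbm (h ?_)⟩
    exact mem_markedLeaves.2 ⟨Finset.mem_insert_self _ _, hm⟩
  · obtain ⟨K, hK, hK'⟩ := Finset.not_subset.1 hsub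
    obtain ⟨hab, hm⟩ := lost K hK hK'
    have hKJ := (mem_markedLeaves.1 hK).1
    refine ⟨?_, fun _ => Or.inr ⟨K, hKJ, hab.mono (subset_insert _ _)⟩⟩
    have : insert b ((A.markedLeaves C J).erase K) ⊆ A.markedLeaves C (insert b J) := by
      intro K1 h1
      rcases Finset.mem_insert.1 h1 with rfl | h1
      · exact mem_markedLeaves.2 ⟨Finset.mem_insert_self _ _, by rwa [union_insert_coe]⟩
      · by_contra h2
        obtain ⟨h3, h4⟩ := Finset.mem_erase.1 h1
        refine h3 ?_
        exact (lost K1 h4 h2).1.unique hab (Or.inr (Or.inr (mem_markedLeaves.1 h4).1))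
          (Or.inr (Or.inr hKJ))
    have h := Finset.card_le_card this
    rw [Finset.card_insert_of_notMem (fun h => hbm (Finset.mem_of_mem_erase h)),
      Finset.card_erase_of_mem hK] at h
    have := Finset.card_pos.2 ⟨K, hK⟩
    omega

/-- A leaf that has the family `E` close below it everywhere runs directly above a leaf of `E`. -/
theorem exists_above_of_exists_near {A : TransverseAtlas ℓ ι} {C : Set Λ} {J : Finset Λ}
    (hE : IsClosed (ℓ ⁻¹' (C ∪ J))) {a : ι} {r : M} (hr : r ∈ A.core a) (hrE : ℓ r ∉ C ∪ J)
    {t : ℝ} (ht : -2 ≤ t) (htr : t < A.height a r) (htE : A.lab a t ∈ C ∪ J)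
    (hC : ∀ s ∈ Icc t (A.height a r), A.lab a s ∉ C)
    (near : ∀ a, ∀ q ∈ A.core a, ℓ q = ℓ r →
      ∃ s, A.height a q - A.eps < s ∧ s < A.height a q ∧ A.lab a s ∈ C ∪ J) :
    ∃ K ∈ J, A.Above (C ∪ J) (ℓ r) K := by
  have hr1 := abs_lt.1 (A.abs_height a r hr)
  obtain ⟨c, h1, h2, h3, h4⟩ := A.exists_last hE a (u := t) (v := A.height a r) (by linarith)
    (by linarith) htr.le htE
  have hcr : c < A.height a r := by
    refine lt_of_le_of_ne h2 ?_
    rintro rfl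
    rw [A.lab_height hr] at h3
    exact hrE h3
  have thin : ∀ a, ∀ q ∈ A.core a, ℓ q = ℓ r → ∀ c, c < A.height a q →
      (∀ s ∈ Ioo c (A.height a q), A.lab a s ∉ C ∪ ↑J) → A.height a q - A.eps < c := by
    intro a q hq hqr c _ hf
    obtain ⟨s, s1, s2, s3⟩ := near a q hq hqr
    by_contra! h
    exact hf s ⟨by linarith, s2⟩ s3
  have hf : ∀ s ∈ Ioo c (A.height a r), A.lab a s ∉ C ∪ ↑J := fun s hs => h4 s ⟨hs.1, hs.2.le⟩
  refine ⟨A.lab a c, h3.resolve_left (hC c ⟨h1, h2⟩), ?_⟩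
  exact A.above_of_direct (fun a q hq hqr c _ hc _ hf => thin a q hq hqr c hc hf)
    (A.core_subset_mid a hr) ⟨c, thin a r hr rfl c hcr hf, hcr, rfl, hf⟩

/-! ### Closedness after adding the relatively closed leaves -/

/-- The union of `C` and the leaves closed outside `C` is closed. -/
theorem mem_relClosed_of_mem_closure [Fintype ι] (A : TransverseAtlas ℓ ι) {C : Set Λ}
    (hC : IsClosed (ℓ ⁻¹' C)) {x : M} (hx : x ∈ closure (ℓ ⁻¹' relClosed ℓ C)) (hxC : ℓ x ∉ C) :
    ℓ x ∈ relClosed ℓ C := by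
  classical
  by_contra hxV
  obtain ⟨z, hz, hzC, hzx⟩ : ∃ z, z ∈ closure (ℓ ⁻¹' {ℓ x}) ∧ ℓ z ∉ C ∧ ℓ z ≠ ℓ x := by
    by_contra! hcon
    refine hxV ⟨hxC, isClosed_of_closure_subset ?_⟩
    rw [insert_eq, preimage_union, closure_union, hC.closure_eq]
    rintro z (hz | hz)
    · by_cases h : ℓ z ∈ C
      · exact Or.inr h
      · exact Or.inl (hcon z hz h)
    · exact Or.inr hz
  -- The leaf of `z` is kept out of `J`, because the final contradiction needs a slab around `z`
  -- free of the chosen `K`.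
  let P : Finset Λ → Prop := fun J => ∀ K ∈ J, K ∈ relClosed ℓ C ∧ K ≠ ℓ z
  have hfreq : ∀ J, P J → ∃ᶠ r in 𝓝 x, (ℓ r ∈ relClosed ℓ C ∧ ℓ r ≠ ℓ z) ∧ ℓ r ∉ J := by
    intro J hJ
    have hcl : IsClosed (ℓ ⁻¹' (C ∪ ↑((insert (ℓ z) J).filter fun K => K ∈ relClosed ℓ C))) :=
      isClosed_union_relClosed hC _ fun K hK => (Finset.mem_filter.1 hK).2
    have hxn : x ∉ ℓ ⁻¹' (C ∪ ↑((insert (ℓ z) J).filter fun K => K ∈ relClosed ℓ C)) := by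
      rintro (h | h)
      · exact hxC h
      · exact hxV (Finset.mem_filter.1 h).2
    refine ((mem_closure_iff_frequently.1 hx).and_eventually
      (hcl.isOpen_compl.mem_nhds hxn)).mono ?_
    rintro r ⟨h1, h2⟩
    have h3 : ℓ r ∉ insert (ℓ z) J := fun h => h2 (Or.inr (Finset.mem_filter.2 ⟨h, h1⟩))
    rw [Finset.mem_insert, not_or] at h3
    exact ⟨⟨h1, h3.1⟩, h3.2⟩
  let N : Finset Λ → ℕ := fun J => (A.markedLeaves C J).card + (A.rev.markedLeaves C J).card
  have hN : ∀ J, N J ≤ Fintype.card ι * A.markers.card + Fintype.card ι * A.rev.markers.card :=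
    fun J => add_le_add (card_markedLeaves_le A C J) (card_markedLeaves_le A.rev C J)
  obtain ⟨J, hJ, hJmax⟩ : ∃ J, P J ∧ ∀ J', P J' → N J' ≤ N J := by
    obtain ⟨J, hJ, h⟩ := (measure fun J : Finset Λ =>
      Fintype.card ι * A.markers.card + Fintype.card ι * A.rev.markers.card - N J).wf.has_min
      {J | P J} ⟨∅, fun K hK => absurd hK (Finset.notMem_empty K)⟩
    refine ⟨J, hJ, fun J' hJ' => ?_⟩
    have h1 : ¬ (_ - N J' < _ - N J) := h J' hJ'
    have := hN J'
    have := hN J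
    omega
  have hP : ∀ J r, P J → ℓ r ∈ relClosed ℓ C ∧ ℓ r ≠ ℓ z → P (insert (ℓ r) J) := by
    intro J r hJ hr K hK
    rcases Finset.mem_insert.1 hK with rfl | hK
    · exact hr
    · exact hJ K hK
  have hPV : ∀ J, P J → ∀ K ∈ J, K ∈ relClosed ℓ C := fun J hJ K hK => (hJ K hK).1
  obtain ⟨a, ha⟩ := A.exists_core x
  have hx1 := abs_lt.1 (A.abs_height a x ha)
  have hax : ContinuousAt (A.axis a) (A.height a x) :=
    (A.continuousOn_axis a).continuousAt (Ioo_mem_nhds (by linarith) (by linarith))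
  have hO : (ℓ ⁻¹' C)ᶜ ∈ 𝓝 (A.axis a (A.height a x)) := by
    refine hC.isOpen_compl.mem_nhds ?_
    rwa [mem_compl_iff, mem_preimage, A.leaf_axis a x ha]
  obtain ⟨η, hη, hball⟩ := Metric.mem_nhds_iff.1 (hax hO)
  have hfree : ∀ s, |s - A.height a x| < η → A.lab a s ∉ C := by
    intro s hs
    have : s ∈ Metric.ball (A.height a x) η := by rwa [Metric.mem_ball, Real.dist_eq]
    exact hball this
  have hnear : ∀ δ > 0, ∀ᶠ r in 𝓝 x, r ∈ A.core a ∧ |A.height a r - A.height a x| < δ := by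
    intro δ hδ
    filter_upwards [(A.isOpen_core a).mem_nhds ha,
      (A.continuousAt_height ha) (Metric.ball_mem_nhds _ hδ)] with p h1 h2
    exact ⟨h1, by rwa [mem_preimage, Metric.mem_ball, Real.dist_eq] at h2⟩
  -- The leaf of `r0` serves as a barrier on one side of `x`: between the height of `r0` and that of
  -- any leaf closer to `x` there is no `C`, so the last plaque of the family met there belongs to a
  -- member of `J1`.
  obtain ⟨r0, ⟨hr0, hr0J⟩, hr0a, hr0η⟩ := ((hfreq J hJ).and_eventually (hnear η hη)).exists
  have hr0x : A.height a r0 ≠ A.height a x := by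
    intro h
    exact hxV (A.leaf_eq_of_height_eq hr0a ha h ▸ hr0.1)
  have hJ1 := hP J r0 hJ hr0
  set J1 := insert (ℓ r0) J with hJ1def
  have hN1 : N J ≤ N J1 :=
    add_le_add (card_markedLeaves_insert A (hPV J hJ) hr0.1 hr0J).1
      (card_markedLeaves_insert A.rev (hPV J hJ) hr0.1 hr0J).1
  have hE1 : IsClosed (ℓ ⁻¹' (C ∪ ↑J1)) := isClosed_union_relClosed hC _ (hPV J1 hJ1)
  have hr0E : A.lab a (A.height a r0) ∈ C ∪ (J1 : Set Λ) := by
    rw [A.lab_height hr0a]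
    exact Or.inr (Finset.mem_insert_self _ _)
  have hr01 := abs_lt.1 (A.abs_height a r0 hr0a)
  have hclass : ∃ᶠ r in 𝓝 x, ∃ K ∈ J1, (ℓ r ∈ relClosed ℓ C ∧ ℓ r ≠ K) ∧
      (A.Above (C ∪ J1) (ℓ r) K ∨ A.rev.Above (C ∪ J1) (ℓ r) K) := by
    refine ((hfreq J1 hJ1).and_eventually
      (hnear _ (abs_pos.2 (sub_ne_zero.2 hr0x)))).mono ?_
    rintro r ⟨⟨hr, hrJ⟩, hra, hrδ⟩
    have hrE : ℓ r ∉ C ∪ (J1 : Set Λ) := by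
      rintro (h | h)
      · exact hr.1.1 h
      · exact hrJ h
    suffices h : (∃ K ∈ J1, A.Above (C ∪ J1) (ℓ r) K) ∨
        ∃ K ∈ J1, A.rev.Above (C ∪ J1) (ℓ r) K by
      rcases h with ⟨K, hK, h⟩ | ⟨K, hK, h⟩
      · exact ⟨K, hK, ⟨hr.1, fun e => hrJ (e ▸ hK)⟩, Or.inl h⟩
      · exact ⟨K, hK, ⟨hr.1, fun e => hrJ (e ▸ hK)⟩, Or.inr h⟩
    have c1 := card_markedLeaves_insert A (hPV J1 hJ1) hr.1 hrJ
    have c2 := card_markedLeaves_insert A.rev (hPV J1 hJ1) hr.1 hrJ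
    have hmax : N (insert (ℓ r) J1) ≤ N J := hJmax _ (hP J1 r hJ1 hr)
    simp only [N] at hmax hN1
    -- If the new leaf owns a marker in either orientation, maximality excludes a strict gain, so it
    -- has displaced some `K`. If it owns none in either orientation, it has close neighbours on
    -- both sides, and the barrier supplies a `K` on its own side.
    by_cases m1 : A.Marked (C ∪ ↑(insert (ℓ r) J1)) (ℓ r)
    · rcases c1.2 m1 with h | h
      · omega
      · exact Or.inl h
    by_cases m2 : A.rev.Marked (C ∪ ↑(insert (ℓ r) J1)) (ℓ r)
    · rcases c2.2 m2 with h | h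
      · omega
      · exact Or.inr h
    rw [union_insert_coe] at m1 m2
    have hE2 : IsClosed (ℓ ⁻¹' insert (ℓ r) (C ∪ ↑J1)) := by
      rw [← union_insert_coe]
      exact isClosed_union_relClosed hC _ (hPV _ (hP J1 r hJ1 hr))
    rw [abs_lt] at hr0η
    rcases lt_or_gt_of_ne hr0x with hlt | hlt
    · rw [abs_of_neg (sub_neg.2 hlt), abs_lt] at hrδ
      left
      refine exists_above_of_exists_near hE1 hra hrE (t := A.height a r0) (by linarith)
        (by linarith) hr0E (fun s hs => hfree s (abs_lt.2 ⟨by linarith [hs.1], ?_⟩)) ?_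
      · linarith [hs.2]
      · intro a q hq hqr
        -- Neighbours below come from the absence of markers in the reversed orientation.
        obtain ⟨s, s1, s2, s3⟩ := exists_near_of_not_marked (A := A.rev) (q := q)
          (by rwa [hqr]) (by rwa [hqr]) hq
        simp only [rev_height] at s1 s2
        have : A.rev.eps = A.eps := rfl
        exact ⟨-s, by linarith, by linarith, s3⟩
    · rw [abs_of_pos (sub_pos.2 hlt), abs_lt] at hrδ
      right
      refine exists_above_of_exists_near (A := A.rev) hE1 hra hrE (t := -A.height a r0)
        (by linarith) (by rw [rev_height]; linarith) (by rwa [rev_lab, neg_neg])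
        (fun s hs => ?_) ?_
      · rw [rev_height] at hs
        exact hfree (-s) (abs_lt.2 ⟨by linarith [hs.2], by linarith [hs.1]⟩)
      · intro a q hq hqr
        obtain ⟨s, s1, s2, s3⟩ := exists_near_of_not_marked (A := A) (q := q)
          (by rwa [hqr]) (by rwa [hqr]) hq
        have : A.rev.eps = A.eps := rfl
        simp only [rev_height, rev_lab]
        exact ⟨-s, by linarith, by linarith, by rwa [neg_neg]⟩
  -- Pigeonhole over the finite family `J1`.
  obtain ⟨K, hK, hKf⟩ : ∃ K ∈ J1, ∃ᶠ r in 𝓝 x, (ℓ r ∈ relClosed ℓ C ∧ ℓ r ≠ K) ∧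
      (A.Above (C ∪ J1) (ℓ r) K ∨ A.rev.Above (C ∪ J1) (ℓ r) K) := by
    by_contra hcon
    refine hclass ?_
    have := (Filter.eventually_all_finset J1).2 fun K hK =>
      not_frequently.1 fun h => hcon ⟨K, hK, h⟩
    filter_upwards [this] with r hr
    rintro ⟨K, hK, h⟩
    exact hr K hK h
  have hKz : ℓ z ≠ K := (hJ1 K hK).2.symm
  simp only [and_or_left, frequently_or_distrib, and_assoc] at hKf
  rcases hKf with h | h
  · exact false_of_frequently_above (A := A) subset_union_left (Or.inr hK) (hJ1 K hK).1 h hz hzC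
      hKz hzx
  · exact false_of_frequently_above (A := A.rev) subset_union_left (Or.inr hK) (hJ1 K hK).1 h hz
      hzC hKz hzx

/-! ### Counting the limit leaves of a leaf -/

/-- A leaf `L` accumulating to an unmarked leaf `K` from above runs directly above `K`. -/
theorem above_of_height_lt {A : TransverseAtlas ℓ ι} {E : Set Λ} (hE : IsClosed (ℓ ⁻¹' E))
    {K : Λ} (hm : ¬ A.Marked E K) {a : ι} {u : M} (hu : u ∈ A.core a) (huE : ℓ u ∉ E) {t : ℝ}
    (ht : -2 ≤ t) (htu : t < A.height a u) (htE : A.lab a t ∈ E)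
    (hK : ∀ s ∈ Icc t (A.height a u), A.lab a s ∈ E → A.lab a s = K) :
    A.Above E (ℓ u) K := by
  have hu1 := abs_lt.1 (A.abs_height a u hu)
  obtain ⟨c, h1, h2, h3, h4⟩ := A.exists_last hE a (u := t) (v := A.height a u) (by linarith)
    (by linarith) htu.le htE
  have hcu : c < A.height a u := by
    refine lt_of_le_of_ne h2 ?_
    rintro rfl
    rw [A.lab_height hu] at h3
    exact huE h3
  have hcK : A.lab a c = K := hK c ⟨h1, h2⟩ h3
  obtain ⟨s, s1, s2, s3⟩ := exists_above_of_not_marked hm (a := a) (c := c) (by linarith)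
    (by linarith) hcK
  have hs : A.height a u ≤ s := by
    by_contra! h
    exact h4 s ⟨s1, h.le⟩ s3
  exact A.above_of_direct
    (fun a q hq _ c hc hcq hK hf => thin_of_not_marked hm hq hc hcq hK hf)
    (A.core_subset_mid a hu) ⟨c, by linarith, hcu, hcK, fun s hs => h4 s ⟨hs.1, hs.2.le⟩⟩

/-- The number of leaves closed outside `C` to which a given leaf outside `C` accumulates is
bounded. -/
theorem card_le_of_subset_closure [Fintype ι] (A : TransverseAtlas ℓ ι) {C : Set Λ}
    (hC : IsClosed (ℓ ⁻¹' C)) (J : Finset Λ) (hJ : ∀ K ∈ J, K ∈ relClosed ℓ C) {x : M}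
    (hxC : ℓ x ∉ C) (hxJ : ℓ x ∉ J)
    (hcl : ∀ K ∈ J, ∃ y, ℓ y = K ∧ y ∈ closure (ℓ ⁻¹' {ℓ x})) :
    J.card ≤ Fintype.card ι * A.markers.card + Fintype.card ι * A.rev.markers.card + 2 := by
  classical
  set E : Set Λ := C ∪ J with hEdef
  have hE : IsClosed (ℓ ⁻¹' E) := isClosed_union_relClosed hC J hJ
  have hxE : ℓ x ∉ E := by
    rintro (h | h)
    · exact hxC h
    · exact hxJ h
  have main : ∀ K ∈ J, K ∉ A.markedLeaves C J → K ∉ A.rev.markedLeaves C J →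
      A.Above E (ℓ x) K ∨ A.rev.Above E (ℓ x) K := by
    intro K hK h1 h2
    have hm1 : ¬ A.Marked E K := fun h => h1 (mem_markedLeaves.2 ⟨hK, h⟩)
    have hm2 : ¬ A.rev.Marked E K := fun h => h2 (mem_markedLeaves.2 ⟨hK, h⟩)
    obtain ⟨y, hyK, hy⟩ := hcl K hK
    obtain ⟨a, ha⟩ := A.exists_core y
    have hy1 := abs_lt.1 (A.abs_height a y ha)
    have hay : ContinuousAt (A.axis a) (A.height a y) :=
      (A.continuousOn_axis a).continuousAt (Ioo_mem_nhds (by linarith) (by linarith))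
    -- Near `y` the only leaf of the family is `K`, so a plaque of the leaf of `x` close to `y` has
    -- `K` as its neighbour, on the side where `y` lies.
    have hO : (ℓ ⁻¹' (C ∪ ↑(J.erase K)))ᶜ ∈ 𝓝 (A.axis a (A.height a y)) := by
      refine (isClosed_union_relClosed hC _ fun K' h =>
        hJ K' (Finset.mem_of_mem_erase h)).isOpen_compl.mem_nhds ?_
      rw [mem_compl_iff, mem_preimage, A.leaf_axis a y ha, hyK]
      rintro (h | h)
      · exact (hJ K hK).1 h
      · exact Finset.notMem_erase K J h
    obtain ⟨η, hη, hball⟩ := Metric.mem_nhds_iff.1 (hay hO)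
    have hfree : ∀ s, |s - A.height a y| < η → A.lab a s ∈ E → A.lab a s = K := by
      intro s hs hsE
      by_contra hne
      have : s ∈ Metric.ball (A.height a y) η := by rwa [Metric.mem_ball, Real.dist_eq]
      refine hball this ?_
      rcases hsE with h | h
      · exact Or.inl h
      · exact Or.inr (Finset.mem_erase.2 ⟨hne, h⟩)
    have hnear : ∀ᶠ r in 𝓝 y, r ∈ A.core a ∧ |A.height a r - A.height a y| < η := by
      filter_upwards [(A.isOpen_core a).mem_nhds ha,
        (A.continuousAt_height ha) (Metric.ball_mem_nhds _ hη)] with p h1 h2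
      exact ⟨h1, by rwa [mem_preimage, Metric.mem_ball, Real.dist_eq] at h2⟩
    obtain ⟨u, ⟨hua, huη⟩, hux⟩ := mem_closure_iff_nhds.1 hy _ hnear
    have hux : ℓ u = ℓ x := hux
    have huE : ℓ u ∉ E := hux ▸ hxE
    have hyE : A.lab a (A.height a y) ∈ E := by
      rw [A.lab_height ha, hyK]
      exact Or.inr hK
    have hne : A.height a y ≠ A.height a u := by
      intro h
      rw [h, A.lab_height hua] at hyE
      exact huE hyE
    rw [abs_lt] at huη
    rcases lt_or_gt_of_ne hne with hlt | hlt
    · left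
      rw [← hux]
      refine above_of_height_lt hE hm1 hua huE (t := A.height a y) (by linarith) hlt hyE
        fun s hs => hfree s (abs_lt.2 ⟨by linarith [hs.1], by linarith [hs.2]⟩)
    · right
      rw [← hux]
      refine above_of_height_lt (A := A.rev) hE hm2 hua huE (t := -A.height a y) (by linarith)
        (neg_lt_neg hlt) (by rwa [rev_lab, neg_neg]) fun s hs => ?_
      rw [rev_height] at hs
      exact hfree (-s) (abs_lt.2 ⟨by linarith [hs.2], by linarith [hs.1]⟩)
  have sub : J ⊆ A.markedLeaves C J ∪ A.rev.markedLeaves C J ∪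
      (J.filter (fun K => A.Above E (ℓ x) K) ∪ J.filter (fun K => A.rev.Above E (ℓ x) K)) := by
    intro K hK
    simp only [Finset.mem_union, Finset.mem_filter]
    have := main K hK
    tauto
  have one : ∀ B : TransverseAtlas ℓ ι, (J.filter (fun K => B.Above E (ℓ x) K)).card ≤ 1 := by
    intro B
    refine Finset.card_le_one.2 fun K hK K' hK' => ?_
    rw [Finset.mem_filter] at hK hK'
    exact hK.2.unique hK'.2 (Or.inr hK.1) (Or.inr hK'.1)
  have h1 := Finset.card_le_card sub
  have h2 := Finset.card_union_le (A.markedLeaves C J ∪ A.rev.markedLeaves C J)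
    (J.filter (fun K => A.Above E (ℓ x) K) ∪ J.filter (fun K => A.rev.Above E (ℓ x) K))
  have h3 := Finset.card_union_le (A.markedLeaves C J) (A.rev.markedLeaves C J)
  have h4 := Finset.card_union_le (J.filter (fun K => A.Above E (ℓ x) K))
    (J.filter (fun K => A.rev.Above E (ℓ x) K))
  have h5 := card_markedLeaves_le A C J
  have h6 := card_markedLeaves_le A.rev C J
  have h7 := one A
  have h8 := one A.rev
  omega

end TransverseAtlas

/-! ### From boxes to a transverse atlas -/

section

open Set Filter

/-- On a compact subinterval a maximum can only sit at the right end, since every other point has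
larger values just after it. -/
theorem strictMonoOn_Ioo_of_eventually_lt {f : ℝ → ℝ} {u v : ℝ} (hf : ContinuousOn f (Ioo u v))
    (h : ∀ s ∈ Ioo u v, ∀ᶠ t in 𝓝[>] s, f s < f t) : StrictMonoOn f (Ioo u v) := by
  intro s hs t ht hst
  have hsub : Icc s t ⊆ Ioo u v := fun x hx => ⟨hs.1.trans_le hx.1, hx.2.trans_lt ht.2⟩
  have key : ∀ m ∈ Icc s t, IsMaxOn f (Icc s t) m → m = t := by
    intro m hm hmax
    by_contra hne
    have hmt : m < t := lt_of_le_of_ne hm.2 hne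
    obtain ⟨x, hx1, hx2⟩ := ((h m (hsub hm)).and (Ioo_mem_nhdsGT hmt)).exists
    exact absurd (hmax ⟨hm.1.trans hx2.1.le, hx2.2.le⟩) (not_le.2 hx1)
  obtain ⟨m, hm, hmax⟩ := isCompact_Icc.exists_isMaxOn ⟨s, left_mem_Icc.2 hst.le⟩ (hf.mono hsub)
  have := key m hm hmax
  subst this
  by_contra! hle
  have : s = m := key s (left_mem_Icc.2 hst.le) fun x hx => (hmax hx).trans hle
  exact hst.ne this

theorem HasDerivAt.eventually_lt_of_pos {f : ℝ → ℝ} {d : ℝ} (hf : HasDerivAt f d 0) (hd : 0 < d) :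
    ∀ᶠ t in 𝓝[>] 0, f 0 < f t := by
  have h := (hasDerivAt_iff_tendsto_slope.1 hf).eventually (lt_mem_nhds hd)
  have h' := h.filter_mono (nhdsWithin_mono 0 fun t (ht : (0 : ℝ) < t) => ht.ne')
  filter_upwards [h', self_mem_nhdsWithin] with t ht ht0
  have ht0 : 0 < t := ht0
  rw [slope_def_field, sub_zero, lt_div_iff₀ ht0] at ht
  linarith

/-- A chart whose image contains the sup-norm ball of radius `3`, on which the leaves are the
fibres of the last coordinate; the curve `γ q` through a point `q` of the box ascends. -/
structure IsBox {M Λ : Type*} [TopologicalSpace M] (ℓ : M → Λ) (γ : M → ℝ → M) {n : ℕ}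
    (ψ : OpenPartialHomeomorph M (Fin (n + 1) → ℝ)) : Prop where
  ball_subset : Metric.ball 0 3 ⊆ ψ.target
  plaque : ∀ y ∈ Metric.ball 0 3, ∀ y' ∈ Metric.ball 0 3, y (Fin.last n) = y' (Fin.last n) →
    ℓ (ψ.symm y) = ℓ (ψ.symm y')
  const : ∀ Z ⊆ ψ.source, IsPreconnected Z → (∀ p ∈ Z, ∀ q ∈ Z, ℓ p = ℓ q) →
    ∀ p ∈ Z, ∀ q ∈ Z, ψ p (Fin.last n) = ψ q (Fin.last n)
  ascends : ∀ q ∈ ψ.source, ψ q ∈ Metric.ball 0 3 →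
    ∃ d > 0, HasDerivAt (fun t => ψ (γ q t) (Fin.last n)) d 0

namespace IsBox

variable {M Λ : Type*} [TopologicalSpace M] {ℓ : M → Λ} {γ : M → ℝ → M} {n : ℕ}
  {ψ ψ' : OpenPartialHomeomorph M (Fin (n + 1) → ℝ)}

theorem mem_ball_iff {y : Fin (n + 1) → ℝ} {r : ℝ} (hr : 0 < r) :
    y ∈ Metric.ball 0 r ↔ ∀ i, |y i| < r := by
  rw [mem_ball_zero_iff, pi_norm_lt_iff hr]
  rfl

theorem update_mem_ball {y : Fin (n + 1) → ℝ} {r s : ℝ} (hy : y ∈ Metric.ball 0 r) (hs : |s| < r) :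
    Function.update y (Fin.last n) s ∈ Metric.ball 0 r := by
  have hr : 0 < r := (abs_nonneg s).trans_lt hs
  rw [mem_ball_iff hr] at hy ⊢
  intro i
  by_cases h : i = Fin.last n
  · subst h; rwa [Function.update_self]
  · rw [Function.update_of_ne h]; exact hy i

/-- Moving upwards in one box is moving upwards in the other. -/
theorem eventually_height_lt (hψ : IsBox ℓ γ ψ) (hψ' : IsBox ℓ γ ψ')
    {r : M} (hγ0 : γ r 0 = r) (hγ : ∀ᶠ t in 𝓝 0, ContinuousAt (γ r) t)
    (hr : r ∈ ψ.source) (hr3 : ψ r ∈ Metric.ball 0 3) (hr' : r ∈ ψ'.source)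
    (hr3' : ψ' r ∈ Metric.ball 0 3) :
    ∀ᶠ s in 𝓝[>] (ψ r (Fin.last n)), ψ' r (Fin.last n) <
      ψ' (ψ.symm (Function.update (ψ r) (Fin.last n) s)) (Fin.last n) := by
  have hO : Metric.ball 0 3 ∩ (ψ.target ∩ ψ.symm ⁻¹' ψ'.source) ∈ 𝓝 (ψ r) := by
    refine inter_mem (Metric.isOpen_ball.mem_nhds hr3)
      ((ψ.isOpen_inter_preimage_symm ψ'.open_source).mem_nhds ⟨ψ.map_source hr, ?_⟩)
    rwa [mem_preimage, ψ.left_inv hr]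
  obtain ⟨δ, hδ, hball⟩ := Metric.mem_nhds_iff.1 hO
  have hup : ∀ y ∈ Metric.ball (ψ r) δ,
      Function.update (ψ r) (Fin.last n) (y (Fin.last n)) ∈ Metric.ball (ψ r) δ := by
    intro y hy
    rw [Metric.mem_ball, dist_pi_lt_iff hδ] at hy ⊢
    intro i
    by_cases h : i = Fin.last n
    · subst h; rw [Function.update_self]; exact hy _
    · rw [Function.update_of_ne h, dist_self]; exact hδ
  -- Near `r` the height in `ψ'` depends only on the height in `ψ`: a horizontal slice of a small
  -- cube is connected and lies in one leaf. So the vertical line may be replaced by the curve `γ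
  -- r`, along which both heights exceed their initial values.
  have hval : ∀ y ∈ Metric.ball (ψ r) δ, ψ' (ψ.symm y) (Fin.last n) =
      ψ' (ψ.symm (Function.update (ψ r) (Fin.last n) (y (Fin.last n)))) (Fin.last n) := by
    intro y hy
    set S := Metric.ball (ψ r) δ ∩ {y' | y' (Fin.last n) = y (Fin.last n)} with hS
    have hconv : Convex ℝ S := by
      refine (convex_ball _ _).inter ?_
      exact convex_hyperplane (LinearMap.proj (R := ℝ) (φ := fun _ : Fin (n + 1) => ℝ)
        (Fin.last n)).isLinear _
    have hcont : ContinuousOn ψ.symm S :=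
      ψ.continuousOn_symm.mono fun y' hy' => (hball hy'.1).2.1
    refine hψ'.const (ψ.symm '' S) ?_ (hconv.isPreconnected.image _ hcont) ?_ _
      ⟨y, ⟨hy, rfl⟩, rfl⟩ _ ⟨_, ⟨hup y hy, ?_⟩, rfl⟩
    · rintro _ ⟨y', hy', rfl⟩
      exact (hball hy'.1).2.2
    · rintro _ ⟨y1, hy1, rfl⟩ _ ⟨y2, hy2, rfl⟩
      exact hψ.plaque _ (hball hy1.1).1 _ (hball hy2.1).1 (hy1.2.trans hy2.2.symm)
    · exact Function.update_self _ _ _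
  obtain ⟨d, hd, hder⟩ := hψ.ascends r hr hr3
  obtain ⟨d', hd', hder'⟩ := hψ'.ascends r hr' hr3'
  have e1 := hder.eventually_lt_of_pos hd
  have e2 := hder'.eventually_lt_of_pos hd'
  simp only [hγ0] at e1 e2
  have hγc : ContinuousAt (γ r) 0 := hγ.self_of_nhds
  have e3 : ∀ᶠ t in 𝓝 (0 : ℝ), γ r t ∈ ψ.source ∧ ψ (γ r t) ∈ Metric.ball (ψ r) δ := by
    have : ψ.source ∩ ψ ⁻¹' Metric.ball (ψ r) δ ∈ 𝓝 (γ r 0) := by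
      rw [hγ0]
      exact (ψ.isOpen_inter_preimage Metric.isOpen_ball).mem_nhds
        ⟨hr, Metric.mem_ball_self hδ⟩
    exact hγc this
  obtain ⟨τ, hτ, hall⟩ := Metric.eventually_nhds_iff.1 (hγ.and e3)
  have e4 := (e1.and e2).and (Ioo_mem_nhdsGT hτ)
  obtain ⟨σ, hσ, hσall⟩ := mem_nhdsGT_iff_exists_Ioo_subset.1 e4
  have hσ : 0 < σ := hσ
  have hhalf : σ / 2 ∈ Ioo 0 σ := ⟨half_pos hσ, half_lt_self hσ⟩
  have hin : ∀ t ∈ Icc 0 (σ / 2), dist t 0 < τ := by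
    intro t ht
    have h5 := (hσall hhalf).2.2
    rw [Real.dist_eq, sub_zero, abs_of_nonneg ht.1]
    exact ht.2.trans_lt h5
  have hcont : ContinuousOn (fun t => ψ (γ r t) (Fin.last n)) (Icc 0 (σ / 2)) := by
    intro t ht
    obtain ⟨h1, h2, -⟩ := hall (hin t ht)
    have h3 : ContinuousAt (fun t => ψ (γ r t)) t := (ψ.continuousAt h2).comp h1
    exact ((continuous_apply (Fin.last n)).continuousAt.comp h3).continuousWithinAt
  filter_upwards [Ioo_mem_nhdsGT (hσall hhalf).1.1] with s hs
  have hs' : s ∈ Ioo (ψ (γ r 0) (Fin.last n)) (ψ (γ r (σ / 2)) (Fin.last n)) := by rwa [hγ0]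
  obtain ⟨t, ht, rfl⟩ := intermediate_value_Ioo (half_pos hσ).le hcont hs'
  obtain ⟨-, h2, h3⟩ := hall (hin t ⟨ht.1.le, ht.2.le⟩)
  rw [← hval _ h3, ψ.left_inv h2]
  exact (hσall ⟨ht.1, ht.2.trans hhalf.2⟩).1.2

/-- The points in question lie in the compact intersection of two closed cubes, of radii `2` and
`1`, and zero displacement is admissible there. The tube lemma gives a uniform radius. -/
theorem exists_radius [T2Space M] (hψ : IsBox ℓ γ ψ) (hψ' : IsBox ℓ γ ψ') :
    ∃ ε > 0, ∀ r ∈ ψ.source, ψ r ∈ Metric.ball 0 2 → r ∈ ψ'.source → ψ' r ∈ Metric.ball 0 1 →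
      ∀ s, |s - ψ r (Fin.last n)| < ε →
        Function.update (ψ r) (Fin.last n) s ∈ Metric.ball 0 3 ∧
        ψ.symm (Function.update (ψ r) (Fin.last n) s) ∈ ψ'.source ∧
        ψ' (ψ.symm (Function.update (ψ r) (Fin.last n) s)) ∈ Metric.ball 0 2 := by
  have hb : ∀ {ψ : OpenPartialHomeomorph M (Fin (n + 1) → ℝ)}, IsBox ℓ γ ψ → ∀ r < 3,
      IsCompact (ψ.symm '' Metric.closedBall 0 r) := by
    intro ψ hψ r hr
    refine (isCompact_closedBall _ _).image_of_continuousOn (ψ.continuousOn_symm.mono ?_)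
    exact (Metric.closedBall_subset_ball hr).trans hψ.ball_subset
  set S := ψ.symm '' Metric.closedBall 0 2 ∩ ψ'.symm '' Metric.closedBall 0 1 with hS
  have hScomp : IsCompact S :=
    (hb hψ 2 (by norm_num)).inter_right (hb hψ' 1 (by norm_num)).isClosed
  set V := ψ'.source ∩ ψ' ⁻¹' Metric.ball 0 2 with hV
  have hVo : IsOpen V := ψ'.isOpen_inter_preimage Metric.isOpen_ball
  let g : M × ℝ → Fin (n + 1) → ℝ := fun x =>
    Function.update (ψ x.1) (Fin.last n) (ψ x.1 (Fin.last n) + x.2)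
  have hg : ContinuousOn g (ψ.source ×ˢ univ) := by
    have h1 : ContinuousOn (fun x : M × ℝ => ψ x.1) (ψ.source ×ˢ univ) :=
      ψ.continuousOn.comp continuous_fst.continuousOn fun x hx => hx.1
    refine continuousOn_pi.2 fun i => ?_
    by_cases hi : i = Fin.last n
    · subst hi
      simp only [g, Function.update_self]
      exact ((continuous_apply (Fin.last n)).comp_continuousOn h1).add continuous_snd.continuousOn
    · simp only [g, Function.update_of_ne hi]
      exact (continuous_apply i).comp_continuousOn h1
  set O := (ψ.source ×ˢ (univ : Set ℝ)) ∩
    g ⁻¹' (Metric.ball 0 3 ∩ (ψ.target ∩ ψ.symm ⁻¹' V)) with hO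
  have hOo : IsOpen O := hg.isOpen_inter_preimage (ψ.open_source.prod isOpen_univ)
    (Metric.isOpen_ball.inter (ψ.isOpen_inter_preimage_symm hVo))
  have hSO : S ×ˢ {(0 : ℝ)} ⊆ O := by
    rintro ⟨r, δ⟩ ⟨⟨⟨y, hy, rfl⟩, y', hy', hyy⟩, rfl⟩
    have hyt : y ∈ ψ.target := hψ.ball_subset (Metric.closedBall_subset_ball (by norm_num) hy)
    have hyt' : y' ∈ ψ'.target := hψ'.ball_subset (Metric.closedBall_subset_ball (by norm_num) hy')
    have hgy : g (ψ.symm y, 0) = y := by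
      simp only [g, add_zero, Function.update_eq_self, ψ.right_inv hyt]
    refine ⟨⟨ψ.map_target hyt, mem_univ _⟩, ?_⟩
    rw [mem_preimage, hgy]
    refine ⟨Metric.closedBall_subset_ball (by norm_num) hy, hyt, ?_⟩
    have hyy : ψ'.symm y' = ψ.symm y := hyy
    rw [mem_preimage, ← hyy]
    refine ⟨ψ'.map_target hyt', ?_⟩
    rw [mem_preimage, ψ'.right_inv hyt']
    exact Metric.closedBall_subset_ball (by norm_num) hy'
  obtain ⟨U, W, -, hWo, hSU, h0W, hUW⟩ :=
    generalized_tube_lemma hScomp isCompact_singleton hOo hSO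
  obtain ⟨ε, hε, hεW⟩ := Metric.isOpen_iff.1 hWo 0 (h0W rfl)
  refine ⟨ε, hε, fun r hr hr2 hr' hr1 s hs => ?_⟩
  have hrS : r ∈ S := ⟨⟨ψ r, Metric.ball_subset_closedBall hr2, ψ.left_inv hr⟩,
    ψ' r, Metric.ball_subset_closedBall hr1, ψ'.left_inv hr'⟩
  have hsW : s - ψ r (Fin.last n) ∈ W := hεW (by rwa [Metric.mem_ball, Real.dist_eq, sub_zero])
  obtain ⟨-, h1, -, h2, h3⟩ := hUW (mk_mem_prod (hSU hrS) hsW)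
  simp only [g, add_sub_cancel, mem_preimage] at h1 h2 h3
  exact ⟨h1, h2, h3⟩

/-- A compact space covered by boxes has a transverse atlas. -/
theorem exists_transverseAtlas [CompactSpace M] [T2Space M] (hγ0 : ∀ r, γ r 0 = r)
    (hγ : ∀ r, ∀ᶠ t in 𝓝 0, ContinuousAt (γ r) t)
    (hbox : ∀ p : M, ∃ ψ : OpenPartialHomeomorph M (Fin (n + 1) → ℝ),
      p ∈ ψ.source ∧ ψ p = 0 ∧ IsBox ℓ γ ψ)
    (hjoin : ∀ p q, ℓ p = ℓ q → JoinedIn (ℓ ⁻¹' {ℓ p}) p q) :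
    ∃ t : Finset M, Nonempty (TransverseAtlas ℓ t) := by
  choose ψ hpψ hψ0 hψ using hbox
  let core : M → Set M := fun a => (ψ a).source ∩ ψ a ⁻¹' Metric.ball 0 1
  have hcoreo : ∀ a, IsOpen (core a) := fun a => (ψ a).isOpen_inter_preimage Metric.isOpen_ball
  have hcore : ∀ p, core p ∈ 𝓝 p := fun p => (hcoreo p).mem_nhds
    ⟨hpψ p, by rw [mem_preimage, hψ0 p]; exact Metric.mem_ball_self one_pos⟩
  obtain ⟨t, -, ht⟩ := isCompact_univ.elim_nhds_subcover core fun p _ => hcore p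
  refine ⟨t, ?_⟩
  let R : M → M → ℝ → Prop := fun a b ε => ∀ r ∈ (ψ a).source, ψ a r ∈ Metric.ball 0 2 →
    r ∈ (ψ b).source → ψ b r ∈ Metric.ball 0 1 → ∀ s, |s - ψ a r (Fin.last n)| < ε →
        Function.update (ψ a r) (Fin.last n) s ∈ Metric.ball 0 3 ∧
        (ψ a).symm (Function.update (ψ a r) (Fin.last n) s) ∈ (ψ b).source ∧
        ψ b ((ψ a).symm (Function.update (ψ a r) (Fin.last n) s)) ∈ Metric.ball 0 2
  have hR : ∀ᶠ ε in 𝓝[>] (0 : ℝ), ∀ a : t, ∀ b : t, R a b ε := by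
    refine eventually_all.2 fun a => eventually_all.2 fun b => ?_
    obtain ⟨ε, hε, h⟩ := (hψ a).exists_radius (hψ b)
    filter_upwards [Ioo_mem_nhdsGT hε] with ε' hε' r h1 h2 h3 h4 s hs
    exact h r h1 h2 h3 h4 s (hs.trans hε'.2)
  obtain ⟨ε, hεR, hε⟩ := (hR.and (Ioo_mem_nhdsGT one_pos)).exists
  have hlast : ∀ {r : ℝ} {y : Fin (n + 1) → ℝ}, 0 < r → y ∈ Metric.ball 0 r →
      |y (Fin.last n)| < r := fun hr hy => (mem_ball_iff hr).1 hy _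
  have hsingle : ∀ {r x : ℝ}, |x| < r → (Pi.single (Fin.last n) x : Fin (n + 1) → ℝ) ∈
      Metric.ball 0 r := fun hx =>
    update_mem_ball (Metric.mem_ball_self ((abs_nonneg _).trans_lt hx)) hx
  have hsc : Continuous (fun s : ℝ => (Pi.single (Fin.last n) s : Fin (n + 1) → ℝ)) :=
    continuous_single (A := fun _ => ℝ) (Fin.last n)
  have huc : ∀ y : Fin (n + 1) → ℝ, Continuous fun s : ℝ => Function.update y (Fin.last n) s :=
    fun y => continuous_const.update _ continuous_id
  have b12 : Metric.ball (0 : Fin (n + 1) → ℝ) 1 ⊆ Metric.ball 0 2 :=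
    Metric.ball_subset_ball (by norm_num)
  have b23 : Metric.ball (0 : Fin (n + 1) → ℝ) 2 ⊆ Metric.ball 0 3 :=
    Metric.ball_subset_ball (by norm_num)
  exact ⟨{
    eps := ε
    eps_pos := hε.1
    eps_le := hε.2.le
    core := fun a => core a
    mid := fun a => (ψ a).source ∩ ψ a ⁻¹' Metric.ball 0 2
    height := fun a p => ψ a p (Fin.last n)
    axis := fun a s => (ψ a).symm (Pi.single (Fin.last n) s)
    isOpen_core := fun a => hcoreo a
    exists_core := fun p => by
      obtain ⟨a, ha, hp⟩ := mem_iUnion₂.1 (ht (mem_univ p))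
      exact ⟨⟨a, ha⟩, hp⟩
    core_subset_mid := fun a p hp => ⟨hp.1, b12 hp.2⟩
    continuousOn_height := fun a => (continuous_apply (Fin.last n)).comp_continuousOn
      ((ψ a).continuousOn.mono inter_subset_left)
    abs_height := fun a p hp => hlast one_pos hp.2
    continuousOn_axis := fun a => by
      refine (ψ a).continuousOn_symm.comp hsc.continuousOn ?_
      intro s hs
      exact (hψ a).ball_subset (hsingle (abs_lt.2 hs))
    axis_mem_mid := fun a s hs => by
      have h := (hψ a).ball_subset (b23 (hsingle hs))
      refine ⟨(ψ a).map_target h, ?_⟩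
      rw [mem_preimage, (ψ a).right_inv h]
      exact hsingle hs
    height_axis := fun a s hs => by
      rw [(ψ a).right_inv ((hψ a).ball_subset (b23 (hsingle hs))), Pi.single_eq_same]
    leaf_axis := fun a p hp => by
      have h3 : ψ a p ∈ Metric.ball 0 3 := b23 (b12 hp.2)
      conv_rhs => rw [← (ψ a).left_inv hp.1]
      refine (hψ a).plaque _ (hsingle ?_) _ h3 (Pi.single_eq_same _ _)
      exact hlast (by norm_num) h3
    eventually_height := fun a p hp W hW => by
      have hc : ContinuousAt (fun s => (ψ a).symm (Function.update (ψ a p) (Fin.last n) s))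
          (ψ a p (Fin.last n)) := by
        refine ContinuousAt.comp ?_ (huc _).continuousAt
        rw [Function.update_eq_self]
        exact (ψ a).continuousAt_symm ((ψ a).map_source hp.1)
      have hW' : W ∩ core a ∈ 𝓝 ((ψ a).symm (Function.update (ψ a p) (Fin.last n)
          (ψ a p (Fin.last n)))) := by
        rw [Function.update_eq_self, (ψ a).left_inv hp.1]
        exact inter_mem hW ((hcoreo a).mem_nhds hp)
      have hlt : |ψ a p (Fin.last n)| < 3 := hlast (by norm_num) (b23 (b12 hp.2))
      filter_upwards [hc hW', continuous_abs.continuousAt.eventually_lt_const hlt] with s hs hs3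
      refine ⟨_, hs.1, hs.2, ?_⟩
      rw [(ψ a).right_inv ((hψ a).ball_subset (update_mem_ball (b23 (b12 hp.2)) hs3)),
        Function.update_self]
    switch := fun a b r hra hrb => by
      have hwin : ∀ s ∈ Ioo (ψ a r (Fin.last n) - ε) (ψ a r (Fin.last n) + ε), _ :=
        fun s hs => hεR a b r hra.1 hra.2 hrb.1 hrb.2 s
          (abs_lt.2 ⟨by linarith [hs.1], by linarith [hs.2]⟩)
      have hcont : ContinuousOn
          (fun s => ψ b ((ψ a).symm (Function.update (ψ a r) (Fin.last n) s)) (Fin.last n))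
          (Ioo (ψ a r (Fin.last n) - ε) (ψ a r (Fin.last n) + ε)) := by
        refine (continuous_apply (Fin.last n)).comp_continuousOn
          ((ψ b).continuousOn.comp ((ψ a).continuousOn_symm.comp
            (huc _).continuousOn ?_) ?_)
        · exact fun s hs => (hψ a).ball_subset (hwin s hs).1
        · exact fun s hs => (hwin s hs).2.1
      refine ⟨_, hcont, strictMonoOn_Ioo_of_eventually_lt hcont ?_, ?_, ?_⟩
      · intro s hs
        obtain ⟨h1, h2, h3⟩ := hwin s hs
        have ht := (hψ a).ball_subset h1
        have hri := (ψ a).right_inv ht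
        have := (hψ a).eventually_height_lt (hψ b) (hγ0 _) (hγ _) ((ψ a).map_target ht)
          (by rwa [hri]) h2 (b23 h3)
        simpa only [hri, Function.update_self, Function.update_idem] using this
      · simp only [Function.update_eq_self, (ψ a).left_inv hra.1]
      · intro s hs
        obtain ⟨h1, h2, h3⟩ := hwin s hs
        have hl := hlast two_pos h3
        refine ⟨hl, ?_⟩
        have e1 := (hψ b).plaque _ (b23 (hsingle hl)) _ (b23 h3) (Pi.single_eq_same _ _)
        rw [(ψ b).left_inv h2] at e1
        refine e1.trans ((hψ a).plaque _ h1 _ (hsingle ?_) ?_)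
        · simpa using hlast (by norm_num) h1
        · rw [Function.update_self, Pi.single_eq_same]
    leaf_chain := fun p q hpq => by
      obtain ⟨c, hc⟩ := hjoin p q hpq
      set Rel : M → M → Prop := fun p q => ∃ a : t, p ∈ core a ∧ q ∈ core a ∧
        ψ a p (Fin.last n) = ψ a q (Fin.last n) with hRel
      -- Along the path the height in a core is locally constant, because short pieces are connected
      -- and stay in one leaf. Hence the parameters reachable by plaque chains form a clopen subset
      -- of the line.
      let e : ℝ → M := fun u => c (projIcc 0 1 zero_le_one u)
      have he : Continuous e := c.continuous.comp continuous_projIcc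
      have hloc : ∀ s : ℝ, ∀ᶠ s' in 𝓝 s, Rel (e s) (e s') := by
        intro s
        obtain ⟨a, ha, hp⟩ := mem_iUnion₂.1 (ht (mem_univ (e s)))
        obtain ⟨δ, hδ, hV⟩ := Metric.mem_nhds_iff.1
          (he.continuousAt.preimage_mem_nhds ((hcoreo a).mem_nhds hp))
        filter_upwards [Metric.ball_mem_nhds s hδ] with s' hs'
        refine ⟨⟨a, ha⟩, hp, hV hs', ?_⟩
        refine (hψ a).const (e '' Metric.ball s δ) ?_
          ((convex_ball s δ).isPreconnected.image _ he.continuousOn) ?_ _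
          ⟨s, Metric.mem_ball_self hδ, rfl⟩ _ ⟨s', hs', rfl⟩
        · rintro _ ⟨u, hu, rfl⟩
          exact (hV hu).1
        · rintro _ ⟨u, -, rfl⟩ _ ⟨u', -, rfl⟩
          have e1 : ℓ (e u) = ℓ p := hc _
          have e2 : ℓ (e u') = ℓ p := hc _
          rw [e1, e2]
      have hclopen : IsClopen {s : ℝ | Relation.EqvGen Rel p (e s)} := by
        constructor
        · rw [← isOpen_compl_iff, isOpen_iff_mem_nhds]
          intro s hs
          filter_upwards [hloc s] with s' hs' h
          exact hs (h.trans _ _ _ (Relation.EqvGen.symm _ _ (Relation.EqvGen.rel _ _ hs')))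
        · rw [isOpen_iff_mem_nhds]
          intro s hs
          filter_upwards [hloc s] with s' hs'
          exact Relation.EqvGen.trans _ _ _ hs (Relation.EqvGen.rel _ _ hs')
      have h0 : e 0 = p := by simp only [e, projIcc_left]; exact c.source
      have h1 : e 1 = q := by simp only [e, projIcc_right]; exact c.target
      have huniv := hclopen.eq_univ ⟨0, by rw [mem_ofPred_eq, h0]; exact Relation.EqvGen.refl _⟩
      have h2 : (1 : ℝ) ∈ {s : ℝ | Relation.EqvGen Rel p (e s)} := huniv ▸ mem_univ _
      rwa [mem_ofPred_eq, h1] at h2 }⟩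

end IsBox

end

/-! ### The leaf map and its behaviour in foliated charts -/

namespace SmoothFoliation

open Set Filter

section Leaves

variable {k n : ℕ} {M : Type*} [TopologicalSpace M] [ChartedSpace (EuclideanSpace ℝ (Fin n)) M]

theorem exists_leaf (F : SmoothFoliation k n M) (p : M) : ∃ L : F.Leaf, p ∈ L.1 := by
  have h : p ∈ ⋃₀ F.leaves := F.sUnion_leaves ▸ mem_univ p
  obtain ⟨L, hL, hp⟩ := h
  exact ⟨⟨L, hL⟩, hp⟩

/-- The leaf through a point. -/
noncomputable def leafOf (F : SmoothFoliation k n M) (p : M) : F.Leaf := (F.exists_leaf p).choose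

theorem mem_leafOf (F : SmoothFoliation k n M) (p : M) : p ∈ (F.leafOf p).1 :=
  (F.exists_leaf p).choose_spec

theorem leafOf_eq (F : SmoothFoliation k n M) {p : M} {L : F.Leaf} (hp : p ∈ L.1) :
    F.leafOf p = L := by
  by_contra hne
  exact disjoint_left.1 (F.pairwiseDisjoint _ (F.leafOf p).2 _ L.2 fun h => hne (Subtype.ext h))
    (F.mem_leafOf p) hp

theorem leafOf_preimage (F : SmoothFoliation k n M) (L : F.Leaf) : F.leafOf ⁻¹' {L} = L.1 := by
  ext p
  exact ⟨fun h => (show F.leafOf p = L from h) ▸ F.mem_leafOf p, fun h => F.leafOf_eq h⟩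

theorem joinedIn_of_leafOf_eq (F : SmoothFoliation k n M) {p q : M}
    (h : F.leafOf p = F.leafOf q) : JoinedIn (F.leafOf ⁻¹' {F.leafOf p}) p q := by
  rw [leafOf_preimage]
  exact (F.isPathConnected _ (F.leafOf p).2).joinedIn p (F.mem_leafOf p) q (h ▸ F.mem_leafOf q)

variable {F : SmoothFoliation k n M} {φ : OpenPartialHomeomorph M (EuclideanSpace ℝ (Fin n))}

theorem leafOf_symm_eq_of_mem_coordSlice (hφ : IsFoliatedChart k F.leaves φ) {p : M}
    (hp : p ∈ φ.source) {y : EuclideanSpace ℝ (Fin n)} (hy : y ∈ coordSlice k φ.target (φ p)) :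
    F.leafOf (φ.symm y) = F.leafOf p := by
  rw [← hφ.2 _ (F.leafOf p).2 _ ⟨p, ⟨hp, F.mem_leafOf p⟩, rfl⟩] at hy
  obtain ⟨q, ⟨hq, hqL⟩, rfl⟩ := connectedComponentIn_subset _ _ hy
  rw [φ.left_inv hq]
  exact F.leafOf_eq hqL

theorem coord_eq_of_isPreconnected (hφ : IsFoliatedChart k F.leaves φ) {Z : Set M}
    (hZ : Z ⊆ φ.source) (hc : IsPreconnected Z) (hl : ∀ p ∈ Z, ∀ q ∈ Z, F.leafOf p = F.leafOf q)
    {p q : M} (hp : p ∈ Z) (hq : q ∈ Z) {j : Fin n} (hj : k ≤ j) : φ p j = φ q j := by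
  have hsub : φ '' Z ⊆ φ '' (φ.source ∩ (F.leafOf q).1) := by
    refine image_mono fun r hr => ⟨hZ hr, ?_⟩
    rw [← hl r hr q hq]
    exact F.mem_leafOf r
  have h := (hc.image φ (φ.continuousOn.mono hZ)).subset_connectedComponentIn
    (mem_image_of_mem φ hq) hsub
  rw [hφ.2 _ (F.leafOf q).2 _ ⟨q, ⟨hZ hq, F.mem_leafOf q⟩, rfl⟩] at h
  exact (h (mem_image_of_mem φ hp)).2 j hj

end Leaves

/-! ### Boxes of a transversely oriented foliation -/

section Boxes

variable {n : ℕ}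

/-- The affine homeomorphism `y ↦ a (y - y₀)`, coordinate by coordinate. -/
noncomputable def coordHomeomorph (y₀ : EuclideanSpace ℝ (Fin (n + 1))) (a : Fin (n + 1) → ℝ)
    (ha : ∀ i, a i ≠ 0) : EuclideanSpace ℝ (Fin (n + 1)) ≃ₜ (Fin (n + 1) → ℝ) where
  toFun y i := a i * (y i - y₀ i)
  invFun z := WithLp.toLp 2 fun i => y₀ i + z i / a i
  left_inv y := by
    ext i
    simp [mul_div_cancel_left₀ _ (ha i)]
  right_inv z := by
    ext i
    simp [mul_div_cancel₀ _ (ha i)]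
  continuous_toFun := by fun_prop
  continuous_invFun := by
    refine (PiLp.continuous_toLp 2 _).comp (continuous_pi fun i => ?_)
    fun_prop

variable {M : Type*} [TopologicalSpace M] [ChartedSpace (EuclideanSpace ℝ (Fin (n + 1))) M]
  [IsManifold (𝓡 (n + 1)) ∞ M]

theorem continuousOn_mfderiv_apply {φ : OpenPartialHomeomorph M (EuclideanSpace ℝ (Fin (n + 1)))}
    (hφ : φ ∈ IsManifold.maximalAtlas (𝓡 (n + 1)) ∞ M) {X : (p : M) → TangentSpace (𝓡 (n + 1)) p}
    (hX : Continuous (fun p => (⟨p, X p⟩ : TangentBundle (𝓡 (n + 1)) M))) :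
    ContinuousOn (fun q => EuclideanSpace.proj (𝕜 := ℝ) (Fin.last n)
      (mfderiv (𝓡 (n + 1)) 𝓘(ℝ, EuclideanSpace ℝ (Fin (n + 1))) φ q (X q))) φ.source := by
  have h1 := (contMDiffOn_of_mem_maximalAtlas hφ).continuousOn_tangentMapWithin
    (by norm_cast) φ.open_source.uniqueMDiffOn
  have h2 : ContinuousOn (fun q => tangentMapWithin (𝓡 (n + 1)) (𝓡 (n + 1)) φ φ.source ⟨q, X q⟩)
      φ.source := h1.comp hX.continuousOn fun q hq => hq
  have h3 := (tangentBundleModelSpaceHomeomorph (𝓡 (n + 1))).continuous.comp_continuousOn h2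
  have h4 := (EuclideanSpace.proj (𝕜 := ℝ) (Fin.last n)).continuous.comp_continuousOn
    (continuous_snd.comp_continuousOn h3)
  refine h4.congr fun q hq => ?_
  simp only [Function.comp, tangentBundleModelSpaceHomeomorph_coe, tangentMapWithin,
    mfderivWithin_of_isOpen φ.open_source hq]
  rfl

theorem exists_isBox {F : SmoothFoliation n (n + 1) M} {X : (p : M) → TangentSpace (𝓡 (n + 1)) p}
    (hX : Continuous (fun p => (⟨p, X p⟩ : TangentBundle (𝓡 (n + 1)) M))) {γ : M → ℝ → M}
    (hγ0 : ∀ r, γ r 0 = r)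
    (hγ : ∀ r, HasMFDerivAt 𝓘(ℝ, ℝ) (𝓡 (n + 1)) (γ r) 0 ((1 : ℝ →L[ℝ] ℝ).smulRight (X (γ r 0))))
    (p : M) (hp : ¬ F.IsTangent p (X p)) :
    ∃ ψ : OpenPartialHomeomorph M (Fin (n + 1) → ℝ),
      p ∈ ψ.source ∧ ψ p = 0 ∧ IsBox F.leafOf γ ψ := by
  simp only [IsTangent, not_forall] at hp
  obtain ⟨φ, hφ, hpφ, j, hj, hne⟩ := hp
  obtain rfl : j = Fin.last n := Fin.ext (le_antisymm (Nat.lt_succ_iff.1 j.2) hj)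
  set w : M → ℝ := fun q => EuclideanSpace.proj (𝕜 := ℝ) (Fin.last n)
      (mfderiv (𝓡 (n + 1)) 𝓘(ℝ, EuclideanSpace ℝ (Fin (n + 1))) φ q (X q)) with hw
  have hwc : ContinuousOn w φ.source := continuousOn_mfderiv_apply hφ.1 hX
  have hwp : w p ≠ 0 := hne
  have hσp : 0 < ((SignType.sign (w p) : SignType) : ℝ) * w p := by
    rw [sign_mul_self]
    exact abs_pos.2 hwp
  -- Multiplying the last coordinate by this sign makes the vector field point upwards at `p`, hence
  -- on a neighbourhood by continuity.
  set σ : ℝ := ((SignType.sign (w p) : SignType) : ℝ) with hσ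
  have hσ1 : |σ| = 1 := by
    rw [hσ]
    rcases lt_or_gt_of_ne hwp with h | h
    · rw [sign_neg h]; simp
    · rw [sign_pos h]; simp
  have hU : IsOpen (φ.source ∩ (fun q => σ * w q) ⁻¹' Ioi 0) :=
    (hwc.const_smul σ).isOpen_inter_preimage φ.open_source isOpen_Ioi
  set U := φ.source ∩ (fun q => σ * w q) ⁻¹' Ioi 0 with hUdef
  have hO : IsOpen (φ.target ∩ φ.symm ⁻¹' U) := φ.isOpen_inter_preimage_symm hU
  have hO' : WithLp.toLp 2 ⁻¹' (φ.target ∩ φ.symm ⁻¹' U) ∈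
      𝓝 (fun i => φ p i : Fin (n + 1) → ℝ) := by
    refine (hO.preimage (PiLp.continuous_toLp 2 _)).mem_nhds ⟨φ.map_source hpφ, ?_⟩
    change φ.symm (φ p) ∈ U
    rw [φ.left_inv hpφ]
    exact ⟨hpφ, hσp⟩
  obtain ⟨δ, hδ, hball⟩ := Metric.mem_nhds_iff.1 hO'
  -- The factor `3 / δ` enlarges the cube of radius `δ` around the image of `p` to radius `3`.
  set a : Fin (n + 1) → ℝ := fun i => (if i = Fin.last n then σ else 1) * (3 / δ) with ha
  have habs : ∀ i, |a i| = 3 / δ := by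
    intro i
    rw [ha, abs_mul, abs_of_pos (div_pos three_pos hδ)]
    split_ifs <;> simp [hσ1]
  have ha0 : ∀ i, a i ≠ 0 := fun i => abs_pos.1 (habs i ▸ div_pos three_pos hδ)
  set H := coordHomeomorph (φ p) a ha0 with hH
  have hHsymm : ∀ z ∈ Metric.ball (0 : Fin (n + 1) → ℝ) 3, H.symm z ∈ φ.target ∩ φ.symm ⁻¹' U := by
    intro z hz
    refine hball (a := fun i => φ p i + z i / a i) ?_
    rw [IsBox.mem_ball_iff three_pos] at hz
    rw [Metric.mem_ball, dist_pi_lt_iff hδ]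
    intro i
    rw [Real.dist_eq, add_sub_cancel_left, abs_div, habs, div_lt_iff₀ (div_pos three_pos hδ),
      mul_div_cancel₀ _ hδ.ne']
    exact hz i
  have hval : ∀ q, φ.transHomeomorph H q (Fin.last n) =
      σ * (3 / δ) * (φ q (Fin.last n) - φ p (Fin.last n)) := by
    intro q
    simp [hH, coordHomeomorph, ha]
  have hsv : ∀ z : Fin (n + 1) → ℝ,
      H.symm z (Fin.last n) = φ p (Fin.last n) + z (Fin.last n) / a (Fin.last n) := fun z => rfl
  refine ⟨φ.transHomeomorph H, hpφ, ?_, ?_, ?_, ?_, ?_⟩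
  · ext i
    simp [hH, coordHomeomorph]
  · exact fun z hz => (hHsymm z hz).1
  · intro y hy y' hy' hyy
    have h1 := hHsymm y hy
    have h2 := hHsymm y' hy'
    refine leafOf_symm_eq_of_mem_coordSlice hφ (φ.map_target h2.1) ⟨h1.1, fun j hj => ?_⟩
    obtain rfl : j = Fin.last n := Fin.ext (le_antisymm (Nat.lt_succ_iff.1 j.2) hj)
    change H.symm y (Fin.last n) = φ (φ.symm (H.symm y')) (Fin.last n)
    rw [φ.right_inv h2.1, hsv, hsv, hyy]
  · intro Z hZ hc hl q hq r hr
    rw [hval, hval, coord_eq_of_isPreconnected hφ hZ hc hl hq hr (j := Fin.last n) le_rfl]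
  · intro q hq hq3
    have hq' : q ∈ φ.source := hq
    have hqU : 0 < σ * w q := by
      have h := (hHsymm _ hq3).2
      have e : H.symm (φ.transHomeomorph H q) = φ q := H.symm_apply_apply _
      rw [e, mem_preimage, φ.left_inv hq'] at h
      exact h.2
    refine ⟨σ * (3 / δ) * w q, ?_, ?_⟩
    · rw [mul_right_comm]
      exact mul_pos hqU (div_pos three_pos hδ)
    · simp only [hval]
      refine HasDerivAt.const_mul _ (HasDerivAt.sub_const _ ?_)
      have h1 : HasMFDerivAt (𝓡 (n + 1)) (𝓡 (n + 1)) φ (γ q 0)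
          (mfderiv (𝓡 (n + 1)) (𝓡 (n + 1)) φ (γ q 0)) := by
        rw [hγ0]
        exact ((contMDiffAt_of_mem_maximalAtlas hφ.1 hq').mdifferentiableAt
          (by norm_num)).hasMFDerivAt
      have h2 := (HasMFDerivAt.comp 0 h1 (hγ q)).hasFDerivAt
      have h3 := ((EuclideanSpace.proj (𝕜 := ℝ) (Fin.last n)).hasFDerivAt.comp 0 h2).hasDerivAt
      refine (show HasDerivAt (fun t => φ (γ q t) (Fin.last n)) _ 0 from h3).congr_deriv ?_
      change EuclideanSpace.proj (𝕜 := ℝ) (Fin.last n)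
        (mfderiv (𝓡 (n + 1)) (𝓡 (n + 1)) φ (γ q 0) ((1 : ℝ) • X (γ q 0))) = _
      rw [one_smul, hγ0]

theorem exists_transverseAtlas [T2Space M] [CompactSpace M] {F : SmoothFoliation n (n + 1) M}
    (hF : F.IsTransverselyOriented) :
    ∃ t : Finset M, Nonempty (TransverseAtlas F.leafOf t) := by
  obtain ⟨X, hX, hXF⟩ := hF
  have h1 : ∀ r, ∃ c : ℝ → M, c 0 = r ∧ IsMIntegralCurveAt c X 0 := fun r =>
    exists_isMIntegralCurveAt_of_contMDiffAt_boundaryless 0 ((hX.of_le (by norm_cast)).contMDiffAt)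
  choose γ hγ0 hγ using h1
  exact IsBox.exists_transverseAtlas hγ0 (fun r => (hγ r).mono fun t ht => ht.continuousAt)
    (fun p => exists_isBox hX.continuous hγ0 (fun r => (hγ r).hasMFDerivAt) p (hXF p))
    fun p q h => F.joinedIn_of_leafOf_eq h

end Boxes
end SmoothFoliation

/-! ### Limit sets, depth and the two assertions -/

namespace SmoothFoliation

open Set Filter

section LimitSet

variable {k n : ℕ} {M : Type*} [TopologicalSpace M] [ChartedSpace (EuclideanSpace ℝ (Fin n)) M]
  {F : SmoothFoliation k n M}

theorem limitSet_subset_closure (L : F.Leaf) : F.limitSet L ⊆ closure L.1 := by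
  rintro y ⟨u, hu, hlim, -⟩
  exact mem_closure_of_tendsto hlim (Eventually.of_forall hu)

/-- A plaque is open in the leaf topology and stays in one leaf. Consequently a sequence in another
leaf never converges to `y` in that topology. -/
theorem mem_nhds_leafTopology (y : M) : (F.leafOf y).1 ∈ @nhds M F.leafTopology y := by
  obtain ⟨φ, hy, hφ⟩ := F.exists_chart y
  have hopen : IsOpen[F.leafTopology] (univ ∩ {q ∈ φ.source | φ q ∈ coordSlice k φ.target (φ y)}) :=
    TopologicalSpace.isOpen_generateFrom_of_mem ⟨φ, hφ, y, hy, univ, isOpen_univ, rfl⟩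
  refine mem_of_superset (@IsOpen.mem_nhds M F.leafTopology _ _ hopen
    ⟨mem_univ _, hy, φ.map_source hy, fun _ _ => rfl⟩) ?_
  rintro q ⟨-, hq, hqs⟩
  have h := leafOf_symm_eq_of_mem_coordSlice hφ hy hqs
  rw [φ.left_inv hq] at h
  exact h ▸ F.mem_leafOf q

theorem mem_limitSet_of_mem_closure [FirstCountableTopology M] {L : F.Leaf} {y : M}
    (hy : y ∈ closure L.1) (hyL : y ∉ L.1) : y ∈ F.limitSet L := by
  obtain ⟨u, hu, hlim⟩ := mem_closure_iff_seq_limit.1 hy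
  refine ⟨u, hu, hlim, fun h => ?_⟩
  obtain ⟨m, hm⟩ := (h.eventually (mem_nhds_leafTopology y)).exists
  have h1 : F.leafOf y = L := (F.leafOf_eq hm).symm.trans (F.leafOf_eq (hu m))
  exact hyL (h1 ▸ F.mem_leafOf y)

/-- For distinct leaves the limit set may be replaced by the closure, so the leaf topology plays no
further role. -/
theorem leafLT_iff [FirstCountableTopology M] {L₁ L₂ : F.Leaf} :
    F.LeafLT L₁ L₂ ↔ L₁ ≠ L₂ ∧ L₁.1 ⊆ closure L₂.1 := by
  constructor
  · exact fun h => ⟨h.2, h.1.trans (limitSet_subset_closure L₂)⟩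
  · rintro ⟨hne, h⟩
    refine ⟨fun y hy => mem_limitSet_of_mem_closure (h hy) fun hy' => hne ?_, hne⟩
    exact (F.leafOf_eq hy).symm.trans (F.leafOf_eq hy')

theorem hasChain_zero (L : F.Leaf) : F.HasChain L 0 := ⟨fun _ => L, fun i => i.elim0, rfl⟩

theorem hasChain_succ_iff {L : F.Leaf} {m : ℕ} :
    F.HasChain L (m + 1) ↔ ∃ L₁, F.LeafLT L₁ L ∧ F.HasChain L₁ m := by
  constructor
  · rintro ⟨c, hc, rfl⟩
    exact ⟨c (Fin.last m).castSucc, hc (Fin.last m), fun i => c i.castSucc,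
      fun i => hc i.castSucc, rfl⟩
  · rintro ⟨L₁, hlt, c, hc, rfl⟩
    refine ⟨Fin.snoc c L, fun i => ?_, Fin.snoc_last _ _⟩
    induction i using Fin.lastCases with
    | last => simpa [Fin.succ_last] using hlt
    | cast i =>
      have h := hc i
      rw [Fin.succ_castSucc, Fin.snoc_castSucc, Fin.snoc_castSucc]
      exact h

theorem depth_le_iff {L : F.Leaf} {d : ℕ} :
    F.depth L ≤ (d : ℕ∞) ↔ ∀ m, F.HasChain L m → m + 1 ≤ d := by
  simp only [depth, iSup_le_iff, Nat.cast_le]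

theorem not_depth_le_zero (L : F.Leaf) : ¬ F.depth L ≤ ((0 : ℕ) : ℕ∞) := fun h =>
  absurd (depth_le_iff.1 h 0 (hasChain_zero L)) (by norm_num)

theorem depth_le_succ_iff {L : F.Leaf} {d : ℕ} :
    F.depth L ≤ ((d + 1 : ℕ) : ℕ∞) ↔ ∀ L₁, F.LeafLT L₁ L → F.depth L₁ ≤ (d : ℕ∞) := by
  simp only [depth_le_iff]
  constructor
  · intro h L₁ hlt m hm
    exact Nat.succ_le_succ_iff.1 (h (m + 1) (hasChain_succ_iff.2 ⟨L₁, hlt, hm⟩))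
  · intro h m hm
    cases m with
    | zero => omega
    | succ m =>
      obtain ⟨L₁, hlt, hm⟩ := hasChain_succ_iff.1 hm
      exact Nat.succ_le_succ (h L₁ hlt m hm)

/-- The leaves of depth at most `d`. -/
def depthLE (F : SmoothFoliation k n M) (d : ℕ) : Set F.Leaf := {L | F.depth L ≤ (d : ℕ∞)}

theorem exists_leafOf_eq (L : F.Leaf) : ∃ p, F.leafOf p = L := by
  obtain ⟨p, hp⟩ := (F.isPathConnected _ L.2).nonempty
  exact ⟨p, F.leafOf_eq hp⟩

variable {ι : Type*}

/-- The closure of a leaf is saturated, so each other leaf it meets is smaller in the order.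
Bounding the depth of all of these by `d` says precisely that the leaf adds no limit points outside
itself and the closed set of depth at most `d`. -/
theorem mem_depthLE_succ_iff [FirstCountableTopology M] (A : TransverseAtlas F.leafOf ι) {d : ℕ}
    (hd : IsClosed (F.leafOf ⁻¹' F.depthLE d)) {L : F.Leaf} :
    L ∈ F.depthLE (d + 1) ↔
      L ∈ F.depthLE d ∨ L ∈ TransverseAtlas.relClosed F.leafOf (F.depthLE d) := by
  constructor
  · intro hL
    by_cases hLd : L ∈ F.depthLE d
    · exact Or.inl hLd
    refine Or.inr ⟨hLd, isClosed_of_closure_subset ?_⟩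
    rw [insert_eq, preimage_union, closure_union, hd.closure_eq]
    rintro z (hz | hz)
    · by_cases hzL : F.leafOf z = L
      · exact Or.inl hzL
      · refine Or.inr (depth_le_succ_iff.1 hL _ (leafLT_iff.2 ⟨hzL, fun y hy => ?_⟩))
        rw [← leafOf_preimage]
        exact A.mem_closure_of_leaf_eq (F.leafOf_eq hy).symm hz
    · exact Or.inr hz
  · rintro (hL | ⟨hL, hcl⟩)
    · have hL : F.depth L ≤ (d : ℕ∞) := hL
      exact hL.trans (by exact_mod_cast Nat.le_succ d)
    · refine depth_le_succ_iff.2 fun L₁ hlt => ?_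
      obtain ⟨hne, hsub⟩ := leafLT_iff.1 hlt
      obtain ⟨p, rfl⟩ := exists_leafOf_eq L₁
      have h1 : L.1 ⊆ F.leafOf ⁻¹' insert L (F.depthLE d) := by
        rw [← leafOf_preimage]
        exact preimage_mono (singleton_subset_iff.2 (mem_insert _ _))
      exact (closure_minimal h1 hcl (hsub (F.mem_leafOf p))).resolve_left hne

theorem isClosed_depthLE [FirstCountableTopology M] [Fintype ι] (A : TransverseAtlas F.leafOf ι)
    (d : ℕ) : IsClosed (F.leafOf ⁻¹' F.depthLE d) := by
  induction d with
  | zero =>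
    have : F.depthLE 0 = ∅ := eq_empty_of_forall_notMem fun L => not_depth_le_zero L
    rw [this, preimage_empty]
    exact isClosed_empty
  | succ d ih =>
    refine isClosed_of_closure_subset fun z hz => ?_
    have h : F.leafOf ⁻¹' F.depthLE (d + 1) =
        F.leafOf ⁻¹' F.depthLE d ∪ F.leafOf ⁻¹' TransverseAtlas.relClosed F.leafOf (F.depthLE d) := by
      ext z
      exact mem_depthLE_succ_iff A ih
    rw [h, closure_union, ih.closure_eq] at hz
    refine (mem_depthLE_succ_iff A ih).2 ?_
    by_cases hzd : F.leafOf z ∈ F.depthLE d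
    · exact Or.inl hzd
    · exact Or.inr (A.mem_relClosed_of_mem_closure ih (hz.resolve_left hzd) hzd)

theorem finite_leafLT_depth_eq [FirstCountableTopology M] [Fintype ι]
    (A : TransverseAtlas F.leafOf ι) (L₀ : F.Leaf) (d : ℕ) :
    {L : F.Leaf | F.LeafLT L L₀ ∧ F.depth L = ((d + 1 : ℕ) : ℕ∞)}.Finite := by
  by_contra hinf
  obtain ⟨J, hJ, hcard⟩ := Set.Infinite.exists_subset_card_eq hinf
    (Fintype.card ι * A.markers.card + Fintype.card ι * A.rev.markers.card + 2 + 1)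
  have hnot : ∀ L : F.Leaf, F.depth L = ((d + 1 : ℕ) : ℕ∞) → L ∉ F.depthLE d := by
    intro L hL h
    have h : F.depth L ≤ (d : ℕ∞) := h
    rw [hL, Nat.cast_le] at h
    omega
  have hcl := isClosed_depthLE A d
  obtain ⟨x, rfl⟩ := exists_leafOf_eq L₀
  -- If `L₀` had depth at most `d`, the smaller leaves would too, contradicting that members of `J`
  -- have depth `d + 1`.
  have hx : F.leafOf x ∉ F.depthLE d := by
    intro hx
    obtain ⟨K, hK⟩ := Finset.card_pos.1 (by omega : 0 < J.card)
    have hx' := (mem_depthLE_succ_iff A hcl).2 (Or.inl hx)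
    exact hnot K (hJ hK).2 (depth_le_succ_iff.1 hx' K (hJ hK).1)
  have := A.card_le_of_subset_closure hcl J (fun K hK => ?_) hx (fun h => (hJ h).1.2 rfl)
    fun K hK => ?_
  · omega
  · exact ((mem_depthLE_succ_iff A hcl).1 (hJ hK).2.le).resolve_left (hnot K (hJ hK).2)
  · obtain ⟨y, rfl⟩ := exists_leafOf_eq K
    refine ⟨y, rfl, ?_⟩
    rw [leafOf_preimage]
    exact (leafLT_iff.1 (hJ hK).1).2 (F.mem_leafOf y)

end LimitSet
end SmoothFoliation

theorem mainTheorem8 {n : ℕ} {M : Type*} [TopologicalSpace M] [T2Space M] [CompactSpace M]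
    [ChartedSpace (EuclideanSpace ℝ (Fin (n + 1))) M] [IsManifold (𝓡 (n + 1)) ∞ M]
    (F : SmoothFoliation n (n + 1) M) (hF : F.IsTransverselyOriented) :
    (∀ (L₀ : F.Leaf) (k : ℕ), 1 ≤ k →
      {L : F.Leaf | F.LeafLT L L₀ ∧ F.depth L = (k : ℕ∞)}.Finite) ∧
    (∀ (k : ℕ) (L : ℕ → F.Leaf) (x : ℕ → M) (y : M) (L' : F.Leaf),
      (∀ i, x i ∈ (L i).1) → Filter.Tendsto x Filter.atTop (𝓝 y) → y ∈ L'.1 →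
      (∀ i, F.depth (L i) ≤ (k : ℕ∞)) → F.depth L' ≤ (k : ℕ∞)) := by
  -- Limit sets are defined by sequences, so passing to closures needs first countability.
  have : SecondCountableTopology M :=
    ChartedSpace.secondCountable_of_sigmaCompact (EuclideanSpace ℝ (Fin (n + 1))) M
  obtain ⟨t, ⟨A⟩⟩ := SmoothFoliation.exists_transverseAtlas hF
  refine ⟨fun L₀ k hk => ?_, fun k L x y L' hx hlim hy hd => ?_⟩
  · obtain ⟨d, rfl⟩ := Nat.exists_eq_add_of_le' hk
    exact SmoothFoliation.finite_leafLT_depth_eq A L₀ d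
  · have h := (SmoothFoliation.isClosed_depthLE A k).mem_of_tendsto hlim (.of_forall fun i => by
      rw [Set.mem_preimage, F.leafOf_eq (hx i)]
      exact hd i)
    rw [Set.mem_preimage, F.leafOf_eq hy] at h
    exact h
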